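/- Let $M$ be a smooth manifold, $g$ a (smooth) pseudo-Riemannian metric on $M$ with Levi-Civita connection $\nabla$, and $J$ a smooth $(1,1)$-tensor field on $M$ with $g(JX,Y)=g(X,JY)$ and $J^2=pJ+qI$, where $p,q$ are real numbers with $p^2+4q>0$ (so $(M,J,g)$ is a metallic pseudo-Riemannian manifold). Put $\sigma_\pm=\frac{p\pm\sqrt{p^2+4q}}{2}$, $$\mathcal P=-\frac{1}{\sqrt{p^2+4q}}J+\frac{\sigma_+}{\sqrt{p^2+4q}}I,\qquad \mathcal P'=\frac{1}{\sqrt{p^2+4q}}J-\frac{\sigma_-}{\sqrt{p^2+4q}}I,$$ and let $\mathcal D=\ker\mathcal P'$, $\mathcal D'=\ker\mathcal P$. A distribution is called integrable if through every point $x\in M$ there passes an (immersed) submanifold $N_x$ of $M$ whose tangent space at each of its points $y$ is the value of the distribution at $y$. For smooth vector fields $X,Y$ on $M$ define - the Nijenhuis tensor $N_J(X,Y)=J\big([JX,Y]+[X,JY]-J[X,Y]\big)-[JX,JY]$; - $H(X,Y)=\mathcal P'(\nabla_{\mathcal PX}\mathcal PY)$, $H'(X,Y)=\mathcal P(\nabla_{\mathcal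 P'X}\mathcal P'Y)$ and the twisting tensors $L(X,Y)=\frac12\big(H(X,Y)-H(Y,X)\big)$, $L'(X,Y)=\frac12\big(H'(X,Y)-H'(Y,X)\big)$; - the Vidal connection $$\tilde{\tilde\nabla}_XY=\mathcal P(\nabla_X\mathcal PY)+\mathcal P'(\nabla_X\mathcal P'Y)-\mathcal P\big((\nabla_{\mathcal PY}\mathcal P')X\big)-\mathcal P'\big((\nabla_{\mathcal P'Y}\mathcal P)X\big).$$ Then the following assertions are equivalent: (i) both distributions $\mathcal D$ and $\mathcal D'$ are integrable; (ii) $N_J=0$; (iii) $L=0$ and $L'=0$; (iv) the Vidal connection is torsion-free, i.e. $\tilde{\tilde\nabla}_XY-\tilde{\tilde\nabla}_YX=[X,Y]$ for all smooth vector fields $X,Y$. -/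

import Mathlib

open Bundle VectorField
open scoped Manifold ContDiff

noncomputable section MetallicDefinitions

universe u

variable {E : Type*} [NormedAddCommGroup E] [NormedSpace ℝ E]
  {H : Type*} [TopologicalSpace H] {I : ModelWithCorners ℝ E H}
  {M : Type u} [TopologicalSpace M] [ChartedSpace H M]

variable (I M) in
/-- A smooth pseudo-Riemannian metric: a smooth field of symmetric nondegenerate bilinear forms on
the tangent spaces, of arbitrary signature. -/
structure PseudoRiemannianMetric [IsManifold I ∞ M] where
  inner (x : M) : TangentSpace I x →L[ℝ] TangentSpace I x →L[ℝ] ℝ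
  symm (x : M) (v w : TangentSpace I x) : inner x v w = inner x w v
  nondegenerate (x : M) (v : TangentSpace I x) (hv : ∀ w, inner x v w = 0) : v = 0
  contMDiff : ContMDiff I (I.prod 𝓘(ℝ, E →L[ℝ] E →L[ℝ] ℝ)) ∞
    (fun x ↦ TotalSpace.mk' (E →L[ℝ] E →L[ℝ] ℝ)
      (E := fun x : M ↦ TangentSpace I x →L[ℝ] TangentSpace I x →L[ℝ] ℝ) x (inner x))

variable (I M) in
/-- A smooth `(1,1)`-tensor field, i.e. a smooth field of endomorphisms of the tangent spaces. -/
structure EndomorphismField [IsManifold I ∞ M] where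
  toFun (x : M) : TangentSpace I x →L[ℝ] TangentSpace I x
  contMDiff : ContMDiff I (I.prod 𝓘(ℝ, E →L[ℝ] E)) ∞
    (fun x ↦ TotalSpace.mk' (E →L[ℝ] E)
      (E := fun x : M ↦ TangentSpace I x →L[ℝ] TangentSpace I x) x (toFun x))

namespace PseudoRiemannianMetric
variable [IsManifold I ∞ M] (g : PseudoRiemannianMetric I M)

/-- `cov` is a Levi-Civita connection of `g`: it is torsion-free, and
`v (g(Y, Z)) = g(∇_v Y, Z) + g(Y, ∇_v Z)`. Here `cov Y x v` is `∇_v Y` at `x`. -/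
structure IsLeviCivita [FiniteDimensional ℝ E] [CompleteSpace E]
    (cov : CovariantDerivative I E (TangentSpace I : M → Type _)) : Prop where
  torsion_eq_zero : cov.torsion = 0
  metric {Y Z : Π x : M, TangentSpace I x} {x : M}
    (hY : MDiffAt (T% Y) x) (hZ : MDiffAt (T% Z) x) (v : TangentSpace I x) :
    d% (fun y ↦ g.inner y (Y y) (Z y)) x v =
      g.inner x (cov Y x v) (Z x) + g.inner x (Y x) (cov Z x v)

lemma mdifferentiableAt_inner {X Y : Π x : M, TangentSpace I x} {x : M}
    (hX : MDiffAt (T% X) x) (hY : MDiffAt (T% Y) x) :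
    MDiffAt (fun y ↦ g.inner y (X y) (Y y)) x := by
  have : MDifferentiableAt I (I.prod 𝓘(ℝ))
      (fun m ↦ TotalSpace.mk' ℝ (E := Bundle.Trivial M ℝ) m (g.inner m (X m) (Y m))) x := by
    apply MDifferentiableAt.clm_bundle_apply₂ (F₁ := E) (F₂ := E)
    · exact g.contMDiff.mdifferentiableAt (by simp)
    · exact hX
    · exact hY
  simp only [mdifferentiableAt_totalSpace] at this
  exact this.2

/-- One half of the Koszul expression; `g(∇_X Y, Z)` for the Levi-Civita connection. -/
def koszul (X Y Z : Π x : M, TangentSpace I x) (x : M) : ℝ :=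
  (1 / 2) * (d% (fun y ↦ g.inner y (Y y) (Z y)) x (X x)
    + d% (fun y ↦ g.inner y (Z y) (X y)) x (Y x)
    - d% (fun y ↦ g.inner y (X y) (Y y)) x (Z x)
    + g.inner x (mlieBracket I X Y x) (Z x)
    - g.inner x (mlieBracket I X Z x) (Y x)
    - g.inner x (mlieBracket I Y Z x) (X x))

lemma tensorialAt_koszul_left [CompleteSpace E] {Y Z : Π x : M, TangentSpace I x} {x : M}
    (hY : MDiffAt (T% Y) x) (hZ : MDiffAt (T% Z) x) :
    TensorialAt I E (fun X ↦ g.koszul X Y Z x) x where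
  smul {f X} hf hX := by
    have h1 := mvfderiv_fun_mul hf (g.mdifferentiableAt_inner hZ hX)
    have h2 := mvfderiv_fun_mul hf (g.mdifferentiableAt_inner hX hY)
    simp [koszul, mlieBracket_smul_left hf hX, h1, h2]
    rw [g.symm x (Z x) (X x)]
    ring
  add {X X'} hX hX' := by
    have h1 := mvfderiv_fun_add (g.mdifferentiableAt_inner hZ hX) (g.mdifferentiableAt_inner hZ hX')
    have h2 := mvfderiv_fun_add (g.mdifferentiableAt_inner hX hY) (g.mdifferentiableAt_inner hX' hY)
    simp [koszul, mlieBracket_add_left hX hX', h1, h2]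
    ring

lemma tensorialAt_koszul_right [CompleteSpace E] {X Y : Π x : M, TangentSpace I x} {x : M}
    (hX : MDiffAt (T% X) x) (hY : MDiffAt (T% Y) x) :
    TensorialAt I E (fun Z ↦ g.koszul X Y Z x) x where
  smul {f Z} hf hZ := by
    have h1 := mvfderiv_fun_mul hf (g.mdifferentiableAt_inner hY hZ)
    have h2 := mvfderiv_fun_mul hf (g.mdifferentiableAt_inner hZ hX)
    simp [koszul, mlieBracket_smul_right hf hZ, h1, h2]
    rw [g.symm x (Z x) (X x), g.symm x (Z x) (Y x)]
    ring
  add {Z Z'} hZ hZ' := by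
    have h1 := mvfderiv_fun_add (g.mdifferentiableAt_inner hY hZ) (g.mdifferentiableAt_inner hY hZ')
    have h2 := mvfderiv_fun_add (g.mdifferentiableAt_inner hZ hX) (g.mdifferentiableAt_inner hZ' hX)
    simp [koszul, mlieBracket_add_right hZ hZ', h1, h2]
    ring

lemma koszul_add [CompleteSpace E] {X Y Y' Z : Π x : M, TangentSpace I x} {x : M}
    (hX : MDiffAt (T% X) x) (hY : MDiffAt (T% Y) x) (hY' : MDiffAt (T% Y') x)
    (hZ : MDiffAt (T% Z) x) :
    g.koszul X (Y + Y') Z x = g.koszul X Y Z x + g.koszul X Y' Z x := by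
  have h1 := mvfderiv_fun_add (g.mdifferentiableAt_inner hY hZ) (g.mdifferentiableAt_inner hY' hZ)
  have h2 := mvfderiv_fun_add (g.mdifferentiableAt_inner hX hY) (g.mdifferentiableAt_inner hX hY')
  simp [koszul, mlieBracket_add_right hY hY', mlieBracket_add_left hY hY', h1, h2]
  ring

lemma koszul_smul [CompleteSpace E] {X Y Z : Π x : M, TangentSpace I x} {f : M → ℝ} {x : M}
    (hX : MDiffAt (T% X) x) (hY : MDiffAt (T% Y) x) (hZ : MDiffAt (T% Z) x) (hf : MDiffAt f x) :
    g.koszul X (f • Y) Z x = f x * g.koszul X Y Z x + d% f x (X x) * g.inner x (Y x) (Z x) := by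
  have h1 := mvfderiv_fun_mul hf (g.mdifferentiableAt_inner hY hZ)
  have h2 := mvfderiv_fun_mul hf (g.mdifferentiableAt_inner hX hY)
  simp [koszul, mlieBracket_smul_right hf hY, mlieBracket_smul_left hf hY, h1, h2]
  rw [g.symm x (X x) (Y x)]
  ring

lemma exists_inner_eq [FiniteDimensional ℝ E] (x : M) (φ : TangentSpace I x →L[ℝ] ℝ) :
    ∃ v, ∀ w, g.inner x v w = φ w := by
  have : FiniteDimensional ℝ (TangentSpace I x) := inferInstanceAs (FiniteDimensional ℝ E)
  let B : TangentSpace I x →ₗ[ℝ] Module.Dual ℝ (TangentSpace I x) :=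
    { toFun v := (g.inner x v).toLinearMap
      map_add' v w := by ext; simp
      map_smul' c v := by ext; simp }
  have hB : Function.Injective B := by
    rw [injective_iff_map_eq_zero]
    intro v hv
    exact g.nondegenerate x v fun w ↦ congr($hv w)
  have hs := (LinearMap.injective_iff_surjective_of_finrank_eq_finrank
    (Subspace.dual_finrank_eq (K := ℝ) (V := TangentSpace I x)).symm).1 hB
  obtain ⟨v, hv⟩ := hs φ.toLinearMap
  exact ⟨v, fun w ↦ congr($hv w)⟩

lemma inner_left_injective {x : M} {v w : TangentSpace I x}
    (h : ∀ u, g.inner x v u = g.inner x w u) : v = w := by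
  rw [← sub_eq_zero]
  exact g.nondegenerate x _ fun u ↦ by simp [h u]

/-- Existence of the Levi-Civita connection, through the Koszul formula. -/
theorem exists_isLeviCivita [FiniteDimensional ℝ E] [CompleteSpace E] :
    ∃ cov : CovariantDerivative I E (TangentSpace I : M → Type _), g.IsLeviCivita cov := by
  classical
  have key (Y : Π x : M, TangentSpace I x) (x : M) :
      ∃ A : TangentSpace I x →L[ℝ] TangentSpace I x, MDiffAt (T% Y) x →
        ∀ X Z : Π x : M, TangentSpace I x, MDiffAt (T% X) x → MDiffAt (T% Z) x →
          g.inner x (A (X x)) (Z x) = g.koszul X Y Z x := by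
    by_cases hY : MDiffAt (T% Y) x
    · let B := TensorialAt.mkHom₂ (fun X Z ↦ g.koszul X Y Z x) x
        (fun Z hZ ↦ g.tensorialAt_koszul_left hY hZ) (fun X hX ↦ g.tensorialAt_koszul_right hX hY)
      choose s hs using g.exists_inner_eq x
      have : FiniteDimensional ℝ (TangentSpace I x) := inferInstanceAs (FiniteDimensional ℝ E)
      let A : TangentSpace I x →ₗ[ℝ] TangentSpace I x :=
        { toFun v := s (B v)
          map_add' v w := g.inner_left_injective fun u ↦ by simp [hs]
          map_smul' c v := g.inner_left_injective fun u ↦ by simp [hs] }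
      have : T2Space (TangentSpace I x) := inferInstanceAs (T2Space E)
      refine ⟨LinearMap.toContinuousLinearMap A, fun _ X Z hX hZ ↦ ?_⟩
      have : g.inner x (A (X x)) (Z x) = B (X x) (Z x) := hs _ _
      refine this.trans ?_
      exact TensorialAt.mkHom₂_apply (Φ := fun X Z ↦ g.koszul X Y Z x)
        (fun Z hZ ↦ g.tensorialAt_koszul_left hY hZ) (fun X hX ↦ g.tensorialAt_koszul_right hX hY)
        hX hZ
    · exact ⟨0, fun h ↦ absurd h hY⟩
  choose cov hcov using key
  have ext {x : M} {A B : TangentSpace I x →L[ℝ] TangentSpace I x}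
      (h : ∀ X Z : Π x : M, TangentSpace I x, MDiffAt (T% X) x → MDiffAt (T% Z) x →
        g.inner x (A (X x)) (Z x) = g.inner x (B (X x)) (Z x)) : A = B := by
    ext v
    refine g.inner_left_injective fun u ↦ ?_
    simpa using h (FiberBundle.extend E v) (FiberBundle.extend E u)
      (FiberBundle.mdifferentiableAt_extend ..) (FiberBundle.mdifferentiableAt_extend ..)
  let D : CovariantDerivative I E (TangentSpace I : M → Type _) :=
    { toFun := cov
      isCovariantDerivativeOnUniv :=
        { add := by
            intro Y Y' x hY hY' _
            refine ext fun X Z hX hZ ↦ ?_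
            have hs : MDiffAt (T% (Y + Y')) x := mdifferentiableAt_add_section hY hY'
            simp [hcov _ _ hs X Z hX hZ, hcov _ _ hY X Z hX hZ, hcov _ _ hY' X Z hX hZ,
              g.koszul_add hX hY hY' hZ]
          leibniz := by
            intro Y f x hY hf _
            refine ext fun X Z hX hZ ↦ ?_
            have hs : MDiffAt (T% (f • Y)) x := hf.smul_section hY
            simp [hcov _ _ hs X Z hX hZ, hcov _ _ hY X Z hX hZ, g.koszul_smul hX hY hZ hf] } }
  refine ⟨D, ?_, ?_⟩
  · rw [CovariantDerivative.torsion_eq_zero_iff]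
    intro X Y x hX hY
    refine g.inner_left_injective fun u ↦ ?_
    have hZ := FiberBundle.mdifferentiableAt_extend I E u
    have h1 := hcov Y x hY X _ hX hZ
    have h2 := hcov X x hX Y _ hY hZ
    simp only [FiberBundle.extend_apply_self] at h1 h2
    simp only [map_sub, sub_apply, D, h1, h2, koszul,
      FiberBundle.extend_apply_self, mlieBracket_swap_apply (V := Y) (W := X), map_neg,
      neg_apply, g.symm _ (Y _) (X _),
      g.symm _ (FiberBundle.extend E u _) (X _), g.symm _ (FiberBundle.extend E u _) (Y _)]
    ring
  · intro Y Z x hY hZ v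
    suffices h : ∀ X : Π x : M, TangentSpace I x, MDiffAt (T% X) x →
        d% (fun y ↦ g.inner y (Y y) (Z y)) x (X x) =
          g.inner x (cov Y x (X x)) (Z x) + g.inner x (Y x) (cov Z x (X x)) by
      simpa using h (FiberBundle.extend E v) (FiberBundle.mdifferentiableAt_extend ..)
    intro X hX
    have h1 := hcov Y x hY X Z hX hZ
    have h2 := hcov Z x hZ X Y hX hY
    rw [g.symm x (Y x)]
    simp only [h1, h2, koszul, mlieBracket_swap_apply (V := Z) (W := Y), map_neg,
      neg_apply, g.symm _ (Z _) (Y _), g.symm _ (Z _) (X _),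
      g.symm _ (Y _) (X _)]
    ring

/-- The Levi-Civita connection of `g`, as an operator on differentiable vector fields. (Its value on
a field that is not differentiable at the point in question is arbitrary and never used.) -/
def leviCivita [FiniteDimensional ℝ E] [CompleteSpace E] :
    CovariantDerivative I E (TangentSpace I : M → Type _) :=
  g.exists_isLeviCivita.choose

theorem leviCivita_isLeviCivita [FiniteDimensional ℝ E] [CompleteSpace E] :
    g.IsLeviCivita g.leviCivita :=
  g.exists_isLeviCivita.choose_spec

/-- `∇_X Y` for the Levi-Civita connection `∇` of `g`. -/
def nabla [FiniteDimensional ℝ E] [CompleteSpace E] (X Y : Π x : M, TangentSpace I x) :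
    Π x : M, TangentSpace I x :=
  fun x ↦ g.leviCivita Y x (X x)

end PseudoRiemannianMetric

/-- A field of endomorphisms `T` applied to a vector field `X`. -/
def applyField (T : Π x : M, TangentSpace I x →L[ℝ] TangentSpace I x)
    (X : Π x : M, TangentSpace I x) : Π x : M, TangentSpace I x :=
  fun x ↦ T x (X x)

variable (I) in
/-- `X` is a smooth vector field. -/
def IsSmoothField [IsManifold I ∞ M] (X : Π x : M, TangentSpace I x) : Prop :=
  ContMDiff I I.tangent ∞ (fun x ↦ (⟨x, X x⟩ : TangentBundle I M))

variable (I) in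
/-- An operator on pairs of vector fields vanishes as a tensor: it is zero on all pairs of smooth
vector fields. -/
def VanishesOnSmooth [IsManifold I ∞ M]
    (B : (Π x : M, TangentSpace I x) → (Π x : M, TangentSpace I x) → Π x : M, TangentSpace I x) :
    Prop :=
  ∀ X Y : Π x : M, TangentSpace I x, IsSmoothField I X → IsSmoothField I Y → B X Y = 0

/-- The torsion `D_X Y - D_Y X - [X, Y]` of a linear connection `D`, written `D X Y`. -/
def torsionOf
    (D : (Π x : M, TangentSpace I x) → (Π x : M, TangentSpace I x) → Π x : M, TangentSpace I x)
    (X Y : Π x : M, TangentSpace I x) : Π x : M, TangentSpace I x :=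
  D X Y - D Y X - mlieBracket I X Y

/-- The covariant derivative `(D_X T) Y = D_X (T Y) - T (D_X Y)` of a field of endomorphisms `T`
with respect to a linear connection `D`. -/
def covDerivEndo
    (D : (Π x : M, TangentSpace I x) → (Π x : M, TangentSpace I x) → Π x : M, TangentSpace I x)
    (T : Π x : M, TangentSpace I x →L[ℝ] TangentSpace I x)
    (X Y : Π x : M, TangentSpace I x) : Π x : M, TangentSpace I x :=
  D X (applyField T Y) - applyField T (D X Y)

/-- A distribution `D` on `M` is integrable if through every point `x` of `M` there passes an
(immersed) submanifold `N` whose tangent space at each of its points `y` is `D y`. The submanifold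
is a manifold `N` with an injective immersion `ι : N → M`; its dimension may depend on `x`. -/
def IsIntegrable [IsManifold I ∞ M] (D : Π x : M, Submodule ℝ (TangentSpace I x)) : Prop :=
  ∀ x : M, ∃ (k : ℕ) (N : Type u) (_ : TopologicalSpace N) (_ : T2Space N)
    (_ : SecondCountableTopology N) (_ : ChartedSpace (EuclideanSpace ℝ (Fin k)) N)
    (_ : IsManifold (𝓡 k) ∞ N) (ι : N → M),
    Manifold.IsImmersion (𝓡 k) I ∞ ι ∧ Function.Injective ι ∧ x ∈ Set.range ι ∧
      ∀ y : N, LinearMap.range (mfderiv (𝓡 k) I ι y).toLinearMap = D (ι y)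

namespace EndomorphismField

variable [IsManifold I ∞ M] (J : EndomorphismField I M)

/-- `(J, g)` is a metallic pseudo-Riemannian structure with `J² = pJ + qI`: the identity holds and
`J` is `g`-symmetric. -/
structure IsMetallic (g : PseudoRiemannianMetric I M) (p q : ℝ) : Prop where
  sq_eq (x : M) (v : TangentSpace I x) : J.toFun x (J.toFun x v) = p • J.toFun x v + q • v
  symm (x : M) (v w : TangentSpace I x) : g.inner x (J.toFun x v) w = g.inner x v (J.toFun x w)

/-- The `J`-bracket `[JX, Y] + [X, JY] - J[X, Y]`. -/
def bracket (X Y : Π x : M, TangentSpace I x) : Π x : M, TangentSpace I x :=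
  mlieBracket I (applyField J.toFun X) Y + mlieBracket I X (applyField J.toFun Y)
    - applyField J.toFun (mlieBracket I X Y)

/-- The Nijenhuis tensor `J([X, Y]_J) - [JX, JY]`. -/
def nijenhuis (X Y : Π x : M, TangentSpace I x) : Π x : M, TangentSpace I x :=
  applyField J.toFun (J.bracket X Y)
    - mlieBracket I (applyField J.toFun X) (applyField J.toFun Y)

/-- The projection `𝒫 = -(1/√(p²+4q)) J + (σ₊/√(p²+4q)) I`, `σ₊ = (p + √(p²+4q))/2`. -/
def proj (p q : ℝ) (x : M) : TangentSpace I x →L[ℝ] TangentSpace I x :=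
  (-(1 / √(p ^ 2 + 4 * q))) • J.toFun x
    + (((p + √(p ^ 2 + 4 * q)) / 2) / √(p ^ 2 + 4 * q)) •
      ContinuousLinearMap.id ℝ (TangentSpace I x)

/-- The projection `𝒫' = (1/√(p²+4q)) J - (σ₋/√(p²+4q)) I`, `σ₋ = (p - √(p²+4q))/2`. -/
def proj' (p q : ℝ) (x : M) : TangentSpace I x →L[ℝ] TangentSpace I x :=
  (1 / √(p ^ 2 + 4 * q)) • J.toFun x
    - (((p - √(p ^ 2 + 4 * q)) / 2) / √(p ^ 2 + 4 * q)) •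
      ContinuousLinearMap.id ℝ (TangentSpace I x)

/-- The metallic distribution `𝒟 = ker 𝒫'`. -/
def distribution (p q : ℝ) (x : M) : Submodule ℝ (TangentSpace I x) :=
  LinearMap.ker (J.proj' p q x).toLinearMap

/-- The metallic distribution `𝒟' = ker 𝒫`. -/
def distribution' (p q : ℝ) (x : M) : Submodule ℝ (TangentSpace I x) :=
  LinearMap.ker (J.proj p q x).toLinearMap

variable [FiniteDimensional ℝ E] [CompleteSpace E] (g : PseudoRiemannianMetric I M)

/-- The deformation tensor `H(X, Y) = 𝒫'(∇_{𝒫X} 𝒫Y)`, `∇` the Levi-Civita connection of `g`. -/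
def deformation (p q : ℝ) (X Y : Π x : M, TangentSpace I x) : Π x : M, TangentSpace I x :=
  applyField (J.proj' p q)
    (g.nabla (applyField (J.proj p q) X) (applyField (J.proj p q) Y))

/-- The deformation tensor `H'(X, Y) = 𝒫(∇_{𝒫'X} 𝒫'Y)`. -/
def deformation' (p q : ℝ) (X Y : Π x : M, TangentSpace I x) : Π x : M, TangentSpace I x :=
  applyField (J.proj p q)
    (g.nabla (applyField (J.proj' p q) X) (applyField (J.proj' p q) Y))

/-- The twisting tensor `L(X, Y) = ½ (H(X, Y) - H(Y, X))`. -/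
def twisting (p q : ℝ) (X Y : Π x : M, TangentSpace I x) : Π x : M, TangentSpace I x :=
  (1 / 2 : ℝ) • (J.deformation g p q X Y - J.deformation g p q Y X)

/-- The twisting tensor `L'(X, Y) = ½ (H'(X, Y) - H'(Y, X))`. -/
def twisting' (p q : ℝ) (X Y : Π x : M, TangentSpace I x) : Π x : M, TangentSpace I x :=
  (1 / 2 : ℝ) • (J.deformation' g p q X Y - J.deformation' g p q Y X)

/-- The Schouten-van Kampen connection `𝒫(∇_X 𝒫Y) + 𝒫'(∇_X 𝒫'Y)` of the Levi-Civita
connection. -/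
def schoutenVanKampen (p q : ℝ) (X Y : Π x : M, TangentSpace I x) : Π x : M, TangentSpace I x :=
  applyField (J.proj p q) (g.nabla X (applyField (J.proj p q) Y))
    + applyField (J.proj' p q) (g.nabla X (applyField (J.proj' p q) Y))

/-- The Vidal connection: the Schouten-van Kampen connection minus
`𝒫((∇_{𝒫Y} 𝒫')X) + 𝒫'((∇_{𝒫'Y} 𝒫)X)`. -/
def vidal (p q : ℝ) (X Y : Π x : M, TangentSpace I x) : Π x : M, TangentSpace I x :=
  J.schoutenVanKampen g p q X Y
    - applyField (J.proj p q)
        (covDerivEndo g.nabla (J.proj' p q) (applyField (J.proj p q) Y) X)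
    - applyField (J.proj' p q)
        (covDerivEndo g.nabla (J.proj p q) (applyField (J.proj' p q) Y) X)

end EndomorphismField

end MetallicDefinitions

/-!
The projections `𝒫` and `𝒫'` are complementary: `𝒫 + 𝒫' = 1` and `𝒫 𝒫' = 𝒫' 𝒫 = 0`, so that
`𝒟 = ker 𝒫'` is the image of `𝒫`, and `𝒟' = ker 𝒫` is the image of `𝒫'`. All four conditions are shown to be
equivalent to involutivity of both distributions, in the form

`𝒫' [𝒫 X, 𝒫 Y] = 0` and `𝒫 [𝒫' X, 𝒫' Y] = 0` for all smooth vector fields `X`, `Y`.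

For the three conditions on tensors and connections this is algebra. Writing `J = σ₋ 𝒫 + σ₊ 𝒫'` and
expanding the brackets, `J.nijenhuis X Y` is `-(p² + 4q)` times the sum of the two expressions above
(`EndomorphismField.nijenhuis_eq`); as the Levi-Civita connection is torsion-free, the twisting
tensors are halves of the two expressions, and the torsion of the Vidal connection is minus their
sum (`EndomorphismField.torsionOf_vidal_eq`). The two summands lie in complementary subspaces, so
the sum vanishes only if both do.

For integrability this is the theorem of Frobenius, for the kernel of a smooth field `Q` of
projections. Read in a chart, `Q` becomes a map `z ↦ Q z` into the endomorphisms of the model space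
`E`, and involutivity says that its derivative is symmetric on the kernel: `DQ z v w = DQ z w v` for
`v, w ∈ ker (Q z)` (`EndomorphismField.IsComplementary.fderiv_symm_of_isInvolutive` and
`EndomorphismField.IsComplementary.isInvolutive_of_fderiv_symm`). If the distribution is integrable,
differentiating `Q (c x) (Dc x a) = 0` along a leaf `c` gives this symmetry, since second
derivatives are symmetric (`fderiv_symm_of_comp_fderiv_eq_zero`).

Conversely, suppose that the symmetry holds. Near a point `z₀`, the kernels of `Q z` are all
projected isomorphically to `V = ker (Q z₀)` along the kernel of `1 - Q z₀`, and inverting the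
projections gives a frame `F z : V → E` of the distribution whose directional derivatives satisfy
`DF z (F z a) b = DF z (F z b) a` (`exists_frame_ker`). A leaf is then a map `c` with derivative
`Dc x = F (c x)`. Along each ray `t ↦ t x` this is an ordinary differential equation; its solution `u`
at time `1` defines `c x`. By the symmetry, `u t + t F (u t) h` solves the equation for `x + h` up
to `O(‖h‖²)`, and Grönwall's inequality shows that `c` has the required derivative
(`norm_sub_sub_le_of_symm`, `exists_hasFDerivAt_of_symm`). The leaf `c` is a section of a linear
projection of `E`, so a shear of the chart straightens it, and it is an immersion
(`isImmersion_symm_comp`).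
-/

/-! ### Integral maps of involutive frames in a Banach space -/

section IntegralMap

open Metric Set Filter Topology
open scoped NNReal

variable {E V : Type*} [NormedAddCommGroup E] [NormedSpace ℝ E]
  [NormedAddCommGroup V] [NormedSpace ℝ V]

lemma gronwallBound_zero_eq_mul (K ε t : ℝ) :
    gronwallBound 0 K ε t = ε * gronwallBound 0 K 1 t := by
  unfold gronwallBound
  split_ifs <;> ring

lemma Convex.norm_image_sub_sub_fderiv_le {G : Type*} [NormedAddCommGroup G] [NormedSpace ℝ G]
    {F : E → G} {s : Set E} {M : ℝ≥0} (hs : Convex ℝ s)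
    (hd : ∀ z ∈ s, DifferentiableAt ℝ F z) (hL : LipschitzOnWith M (fderiv ℝ F) s)
    {u a : E} (hu : u ∈ s) (ha : a ∈ s) :
    ‖F a - F u - fderiv ℝ F u (a - u)‖ ≤ M * ‖a - u‖ ^ 2 := by
  have hsub : segment ℝ u a ⊆ s := hs.segment_subset hu ha
  have := (convex_segment u a).norm_image_sub_le_of_norm_hasFDerivWithin_le'
    (f := F) (f' := fderiv ℝ F) (φ := fderiv ℝ F u) (C := M * ‖a - u‖)
    (fun y hy ↦ (hd y (hsub hy)).hasFDerivAt.hasFDerivWithinAt)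
    (fun y hy ↦ (hL.norm_sub_le (hsub hy) hu).trans
      (by gcongr; exact norm_sub_le_of_mem_segment hy))
    (left_mem_segment ℝ u a) (right_mem_segment ℝ u a)
  refine this.trans_eq ?_
  ring

/-- A solution of `u' = F(u) x` on `[0, 1]` which stays in a given ball, for a small parameter
`x`. -/
lemma exists_solution_mem_closedBall [CompleteSpace E] {F : E → V →L[ℝ] E} {z₀ : E} {a M : ℝ≥0}
    (hb : ∀ z ∈ closedBall z₀ a, ‖F z‖ ≤ M) (hl : LipschitzOnWith M F (closedBall z₀ a))
    {x : V} (hx : M * ‖x‖ ≤ a) :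
    ∃ u : ℝ → E, u 0 = z₀ ∧ (∀ t, u t ∈ closedBall z₀ a) ∧
      ∀ t ∈ Icc (0 : ℝ) 1, HasDerivWithinAt u (F (u t) x) (Icc 0 1) t := by
  have hf : IsPicardLindelof (fun _ z ↦ F z x) (tmin := 0) (tmax := 1) ⟨0, by simp⟩ z₀ a 0
      (M * ‖x‖₊) (M * ‖x‖₊) := by
    refine IsPicardLindelof.of_time_independent (fun z hz ↦ ?_) ?_ (by simpa using hx)
    · exact ((F z).le_opNorm x).trans (by push_cast; gcongr; exact hb z hz)
    · refine LipschitzOnWith.of_dist_le_mul fun z hz w hw ↦ ?_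
      rw [dist_eq_norm, ← sub_apply]
      refine ((F z - F w).le_opNorm x).trans ?_
      have := hl.dist_le_mul z hz w hw
      rw [dist_eq_norm] at this
      push_cast
      nlinarith [norm_nonneg x]
  obtain ⟨α, hα⟩ := ODE.FunSpace.exists_isFixedPt_next hf (mem_closedBall_self le_rfl)
  refine ⟨α.compProj, ?_, fun t ↦ α.compProj_mem_closedBall hf.mul_max_le, fun t ht ↦ ?_⟩
  · have := ODE.FunSpace.compProj_val (α := α) (t := ⟨0, by simp⟩)
    simp only at this
    rw [this, ← hα, ODE.FunSpace.next_apply₀]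
  · refine ODE.hasDerivWithinAt_picard_Icc (f := fun _ z ↦ F z x) (u := closedBall z₀ a)
      (t₀ := 0) (by simp) hf.continuousOn_uncurry
      α.continuous_compProj.continuousOn (fun _ _ ↦ α.compProj_mem_closedBall hf.mul_max_le)
      z₀ ht |>.congr_of_mem (fun t' ht' ↦ ?_) ht
    nth_rw 1 [← hα]
    rw [ODE.FunSpace.compProj_of_mem ht', ODE.FunSpace.next_apply]

/-- If `u` solves `u' = F(u) x` and `v` solves `v' = F(v)(x + h)` from the same initial value, then
`v(1) = u(1) + F(u(1)) h + O(‖h‖²)`. The symmetry assumption says exactly that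
`t ↦ u(t) + t F(u(t)) h` solves the equation of `v` up to `O(‖h‖²)`, so that Grönwall's inequality
applies. -/
lemma norm_sub_sub_le_of_symm {F : E → V →L[ℝ] E} {z₀ : E} {R M : ℝ≥0}
    (hd : ∀ z ∈ closedBall z₀ R, DifferentiableAt ℝ F z)
    (hb : ∀ z ∈ closedBall z₀ R, ‖F z‖ ≤ M) (hb' : ∀ z ∈ closedBall z₀ R, ‖fderiv ℝ F z‖ ≤ M)
    (hl : LipschitzOnWith M F (closedBall z₀ R))
    (hl' : LipschitzOnWith M (fderiv ℝ F) (closedBall z₀ R))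
    (hsymm : ∀ z ∈ closedBall z₀ R, ∀ h x, fderiv ℝ F z (F z h) x = fderiv ℝ F z (F z x) h)
    {x h : V} (hxh : ‖x + h‖ ≤ 1) (hh : M * ‖h‖ ≤ R / 2) {u v : ℝ → E} (h0 : u 0 = v 0)
    (hu : ∀ t, u t ∈ closedBall z₀ (R / 2)) (hv : ∀ t, v t ∈ closedBall z₀ R)
    (hu' : ∀ t ∈ Icc (0 : ℝ) 1, HasDerivWithinAt u (F (u t) x) (Icc 0 1) t)
    (hv' : ∀ t ∈ Icc (0 : ℝ) 1, HasDerivWithinAt v (F (v t) (x + h)) (Icc 0 1) t) :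
    ‖v 1 - u 1 - F (u 1) h‖ ≤ (M ^ 3 + M ^ 2) * gronwallBound 0 M 1 1 * ‖h‖ ^ 2 := by
  have huR (t) : u t ∈ closedBall z₀ R := closedBall_subset_closedBall (by simp) (hu t)
  set a : ℝ → E := fun t ↦ u t + t • F (u t) h with ha
  have hFh (t) : ‖F (u t) h‖ ≤ M * ‖h‖ :=
    ((F (u t)).le_opNorm h).trans (by gcongr; exact hb _ (huR t))
  have hau (t) (ht : t ∈ Icc (0 : ℝ) 1) : ‖a t - u t‖ ≤ M * ‖h‖ := by
    simp only [ha, add_sub_cancel_left, norm_smul, Real.norm_eq_abs, abs_of_nonneg ht.1]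
    nlinarith [hFh t, ht.1, ht.2, norm_nonneg (F (u t) h)]
  have haR (t) (ht : t ∈ Icc (0 : ℝ) 1) : a t ∈ closedBall z₀ R := by
    have h1 := hau t ht
    have h2 := hu t
    rw [mem_closedBall, dist_eq_norm] at h2 ⊢
    have := norm_add_le (a t - u t) (u t - z₀)
    rw [sub_add_sub_cancel] at this
    linarith
  have ha' (t) (ht : t ∈ Icc (0 : ℝ) 1) : HasDerivWithinAt a
      (F (u t) x + (t • fderiv ℝ F (u t) (F (u t) x) h + (1 : ℝ) • F (u t) h)) (Icc 0 1) t := by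
    have h1 : HasDerivWithinAt (fun t ↦ F (u t)) (fderiv ℝ F (u t) (F (u t) x)) (Icc 0 1) t :=
      (hd _ (huR t)).hasFDerivAt.comp_hasDerivWithinAt t (hu' t ht)
    have h2 : HasDerivWithinAt (fun t ↦ F (u t) h) (fderiv ℝ F (u t) (F (u t) x) h)
        (Icc 0 1) t := by
      simpa using h1.clm_apply (hasDerivWithinAt_const t _ h)
    exact (hu' t ht).add ((hasDerivWithinAt_id t _).smul h2)
  have herr (t) (ht : t ∈ Icc (0 : ℝ) 1) :
      ‖F (u t) x + (t • fderiv ℝ F (u t) (F (u t) x) h + (1 : ℝ) • F (u t) h) - F (a t) (x + h)‖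
        ≤ (M ^ 3 + M ^ 2) * ‖h‖ ^ 2 := by
    have e : F (u t) x + (t • fderiv ℝ F (u t) (F (u t) x) h + (1 : ℝ) • F (u t) h)
        - F (a t) (x + h) = -((F (a t) - F (u t) - fderiv ℝ F (u t) (a t - u t)) (x + h))
          - t • fderiv ℝ F (u t) (F (u t) h) h := by
      rw [← hsymm _ (huR t) h x]
      simp only [ha, add_sub_cancel_left, map_smul, sub_apply, map_add, smul_apply, one_smul]
      abel
    rw [e]
    have h1 := (convex_closedBall z₀ (R : ℝ)).norm_image_sub_sub_fderiv_le hd hl' (huR t) (haR t ht)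
    have h2 : ‖(F (a t) - F (u t) - fderiv ℝ F (u t) (a t - u t)) (x + h)‖
        ≤ M ^ 3 * ‖h‖ ^ 2 := by
      refine (ContinuousLinearMap.le_opNorm _ _).trans ?_
      calc _ ≤ (M * ‖a t - u t‖ ^ 2) * 1 := by gcongr
        _ ≤ (M * (M * ‖h‖) ^ 2) * 1 := by gcongr; exact hau t ht
        _ = _ := by ring
    have h3 : ‖t • fderiv ℝ F (u t) (F (u t) h) h‖ ≤ M ^ 2 * ‖h‖ ^ 2 := by
      rw [norm_smul, Real.norm_eq_abs, abs_of_nonneg ht.1]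
      calc _ ≤ 1 * (‖fderiv ℝ F (u t)‖ * ‖F (u t) h‖ * ‖h‖) := by
              gcongr
              · exact ht.2
              · exact ContinuousLinearMap.le_opNorm₂ _ _ _
        _ ≤ 1 * (M * (M * ‖h‖) * ‖h‖) := by
              gcongr
              · exact hb' _ (huR t)
              · exact hFh t
        _ = _ := by ring
    calc _ ≤ _ := norm_sub_le _ _
      _ ≤ _ := by rw [norm_neg]; linarith
  have key := dist_le_of_approx_trajectories_ODE_of_mem (v := fun _ z ↦ F z (x + h))
    (s := fun _ ↦ closedBall z₀ R) (K := M) (f := a) (g := v) (a := 0) (b := 1) (δ := 0) (εg := 0)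
    (fun t _ ↦ ?_) (fun t ht ↦ (ha' t ht).continuousWithinAt)
    (fun t ht ↦ (ha' t (Ico_subset_Icc_self ht)).mono_of_mem_nhdsWithin (Icc_mem_nhdsGE_of_mem ht))
    (fun t ht ↦ by rw [dist_eq_norm]; exact herr t (Ico_subset_Icc_self ht))
    (fun t ht ↦ haR t (Ico_subset_Icc_self ht)) (fun t ht ↦ (hv' t ht).continuousWithinAt)
    (fun t ht ↦ (hv' t (Ico_subset_Icc_self ht)).mono_of_mem_nhdsWithin (Icc_mem_nhdsGE_of_mem ht))
    (fun t _ ↦ by simp) (fun t _ ↦ hv t) (by simp [ha, h0]) 1 (by simp)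
  · rw [gronwallBound_zero_eq_mul, dist_comm, dist_eq_norm] at key
    simp only [ha, one_smul, add_zero, sub_zero] at key
    rw [← sub_sub] at key
    linarith
  · refine LipschitzOnWith.of_dist_le_mul fun z hz w hw ↦ ?_
    rw [dist_eq_norm, ← sub_apply]
    refine ((F z - F w).le_opNorm _).trans ?_
    have := hl.dist_le_mul z hz w hw
    rw [dist_eq_norm] at this
    nlinarith [norm_nonneg (F z - F w)]

/-- **Frobenius theorem**, for a frame `F` of commuting vector fields `z ↦ F z x`: there is a map
`φ` through `z₀` with differential `F (φ x)` at `x`. -/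
theorem exists_hasFDerivAt_of_symm [CompleteSpace E] {F : E → V →L[ℝ] E} {U : Set E}
    (hU : IsOpen U) (hF : ContDiffOn ℝ 2 F U)
    (hsymm : ∀ z ∈ U, ∀ h x, fderiv ℝ F z (F z h) x = fderiv ℝ F z (F z x) h)
    {z₀ : E} (hz₀ : z₀ ∈ U) :
    ∃ r > 0, ∃ φ : V → E, φ 0 = z₀ ∧
      ∀ x ∈ ball (0 : V) r, φ x ∈ U ∧ HasFDerivAt φ (F (φ x)) x := by
  have hFz : ContDiffAt ℝ 2 F z₀ := hF.contDiffAt (hU.mem_nhds hz₀)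
  have hF1 : ContDiffAt ℝ 1 (fderiv ℝ F) z₀ := hFz.fderiv_right (by norm_num)
  obtain ⟨K₁, s₁, hs₁, hl₁⟩ := (hFz.of_le one_le_two).exists_lipschitzOnWith
  obtain ⟨K₂, s₂, hs₂, hl₂⟩ := hF1.exists_lipschitzOnWith
  have hb₁ : ∀ᶠ z in 𝓝 z₀, ‖F z‖ < ‖F z₀‖ + 1 :=
    hFz.continuousAt.norm.eventually_lt_const (by simp)
  have hb₂ : ∀ᶠ z in 𝓝 z₀, ‖fderiv ℝ F z‖ < ‖fderiv ℝ F z₀‖ + 1 :=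
    (((continuous_norm (E := E →L[ℝ] V →L[ℝ] E)).tendsto _).comp
      hF1.continuousAt).eventually_lt_const (lt_add_one _)
  obtain ⟨R', hR', hR'U⟩ := nhds_basis_closedBall.mem_iff.1
    (inter_mem (hU.mem_nhds hz₀) (inter_mem (inter_mem hs₁ hs₂) (hb₁.and hb₂)))
  lift R' to ℝ≥0 using hR'.le
  -- A single constant which bounds `F`, its derivative and both Lipschitz constants.
  set M : ℝ≥0 := K₁ + K₂ + (‖F z₀‖₊ + 1) + (‖fderiv ℝ F z₀‖₊ + 1) with hM
  have hM1 : (1 : ℝ) ≤ M := by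
    simp only [hM]; push_cast
    have := norm_nonneg (F z₀)
    have := norm_nonneg (fderiv ℝ F z₀)
    linarith [K₁.coe_nonneg, K₂.coe_nonneg]
  have hd : ∀ z ∈ closedBall z₀ R', DifferentiableAt ℝ F z := fun z hz ↦
    (hF.contDiffAt (hU.mem_nhds (hR'U hz).1)).differentiableAt (by norm_num)
  have hb : ∀ z ∈ closedBall z₀ R', ‖F z‖ ≤ M := fun z hz ↦ by
    have := (hR'U hz).2.2.1
    simp only [hM]; push_cast
    linarith [K₁.coe_nonneg, K₂.coe_nonneg, norm_nonneg (fderiv ℝ F z₀)]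
  have hb' : ∀ z ∈ closedBall z₀ R', ‖fderiv ℝ F z‖ ≤ M := fun z hz ↦ by
    have := (hR'U hz).2.2.2
    simp only [hM]; push_cast
    linarith [K₁.coe_nonneg, K₂.coe_nonneg, norm_nonneg (F z₀)]
  have hl : LipschitzOnWith M F (closedBall z₀ R') :=
    (hl₁.mono fun z hz ↦ (hR'U hz).2.1.1).weaken (by rw [hM, add_assoc, add_assoc]; simp)
  have hl' : LipschitzOnWith M (fderiv ℝ F) (closedBall z₀ R') :=
    (hl₂.mono fun z hz ↦ (hR'U hz).2.1.2).weaken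
      (by rw [hM, add_comm K₁, add_assoc, add_assoc]; simp)
  have hs : ∀ z ∈ closedBall z₀ R', ∀ h x,
      fderiv ℝ F z (F z h) x = fderiv ℝ F z (F z x) h := fun z hz ↦ hsymm z (hR'U hz).1
  -- Solutions with parameter `x`, `‖x‖ ≤ r`, have speed at most `M r ≤ R' / 2`. They stay in half
  -- the ball, which leaves room for the approximate solution in `norm_sub_sub_le_of_symm`.
  set r : ℝ := min 1 (R' / 2 / M) with hr
  have hrpos : 0 < r := by positivity
  have hrM {x : V} (hx : x ∈ ball (0 : V) r) : M * ‖x‖ ≤ ((R' / 2 : ℝ≥0) : ℝ) := by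
    have h1 : ‖x‖ ≤ R' / 2 / M := (mem_ball_zero_iff.1 hx).le.trans (min_le_right _ _)
    rw [le_div_iff₀ (by positivity)] at h1
    push_cast
    linarith
  have hsub : closedBall z₀ ((R' / 2 : ℝ≥0) : ℝ) ⊆ closedBall z₀ R' :=
    closedBall_subset_closedBall (by push_cast; linarith)
  have hsol (x : V) (hx : x ∈ ball (0 : V) r) := exists_solution_mem_closedBall
    (fun z hz ↦ hb z (hsub hz)) (hl.mono hsub) (hrM hx)
  choose! u hu0 hu hu' using hsol
  refine ⟨r, hrpos, fun x ↦ u x 1, ?_, fun x hx ↦ ⟨(hR'U (hsub (hu x hx 1))).1, ?_⟩⟩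
  · have h0 : (0 : V) ∈ ball (0 : V) r := by simpa using hrpos
    -- The solution with parameter `0` is constant.
    have : ∀ t ∈ Icc (0 : ℝ) 1, u 0 t = u 0 0 := by
      refine constant_of_has_deriv_right_zero
        (fun t ht ↦ (hu' 0 h0 t ht).continuousWithinAt) fun t ht ↦ ?_
      simpa using (hu' 0 h0 t (Ico_subset_Icc_self ht)).mono_of_mem_nhdsWithin
        (Icc_mem_nhdsGE_of_mem ht)
    simp only
    rw [this 1 (by simp), hu0 0 h0]
  · rw [hasFDerivAt_iff_isLittleO_nhds_zero]
    have hO : (fun h ↦ u (x + h) 1 - u x 1 - F (u x 1) h) =O[𝓝 0] fun h ↦ ‖h‖ ^ 2 := by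
      refine Asymptotics.IsBigO.of_bound ((M ^ 3 + M ^ 2) * gronwallBound 0 M 1 1) ?_
      have h1 : ∀ᶠ h in 𝓝 (0 : V), x + h ∈ ball (0 : V) r := by
        have : Tendsto (fun h : V ↦ x + h) (𝓝 0) (𝓝 x) :=
          (continuous_const.add continuous_id).tendsto' _ _ (by simp)
        exact this.eventually (isOpen_ball.mem_nhds hx)
      filter_upwards [h1, ball_mem_nhds (0 : V) hrpos] with h hxh hh
      rw [norm_pow, norm_norm]
      refine norm_sub_sub_le_of_symm hd hb hb' hl hl' hs
        ((mem_ball_zero_iff.1 hxh).le.trans (min_le_left _ _)) (by simpa using hrM hh) ?_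
        (by simpa using hu x hx) (fun t ↦ hsub (hu _ hxh t)) (hu' x hx) (hu' _ hxh)
      rw [hu0 x hx, hu0 _ hxh]
    exact hO.trans_isLittleO (Asymptotics.isLittleO_norm_pow_id one_lt_two)

lemma contDiffOn_of_hasFDerivAt_comp {F : E → V →L[ℝ] E} {U : Set E} {φ : V → E} {s : Set V}
    (hs : IsOpen s) (hF : ContDiffOn ℝ ∞ F U)
    (hφ : ∀ x ∈ s, φ x ∈ U ∧ HasFDerivAt φ (F (φ x)) x) : ContDiffOn ℝ ∞ φ s := by
  rw [contDiffOn_infty]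
  intro n
  induction n with
  | zero =>
    exact contDiffOn_zero.2 fun x hx ↦ (hφ x hx).2.continuousAt.continuousWithinAt
  | succ n ih =>
    have h1 : ContDiffOn ℝ n (fun x ↦ F (φ x)) s :=
      (hF.of_le (mod_cast le_top)).comp ih fun x hx ↦ (hφ x hx).1
    push_cast
    rw [contDiffOn_succ_iff_fderiv_of_isOpen hs]
    exact ⟨fun x hx ↦ (hφ x hx).2.differentiableAt.differentiableWithinAt, by simp,
      h1.congr fun x hx ↦ (hφ x hx).2.fderiv⟩

end IntegralMap

/-! ### The metallic projections, and the tensor conditions in terms of brackets -/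

section Algebra

variable {E : Type*} [NormedAddCommGroup E] [NormedSpace ℝ E]
  {H : Type*} [TopologicalSpace H] {I : ModelWithCorners ℝ E H}
  {M : Type*} [TopologicalSpace M] [ChartedSpace H M] [IsManifold I ∞ M]

namespace IsSmoothField

variable {X : Π x : M, TangentSpace I x}

lemma mdifferentiableAt (hX : IsSmoothField I X) (x : M) : MDiffAt (T% X) x :=
  (hX x).mdifferentiableAt (by simp)

lemma const_smul (c : ℝ) (hX : IsSmoothField I X) : IsSmoothField I (c • X) :=
  ContMDiff.const_smul_section hX

lemma applyField (J : EndomorphismField I M) (hX : IsSmoothField I X) :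
    IsSmoothField I (applyField J.toFun X) :=
  ContMDiff.clm_bundle_apply (F₁ := E) (F₂ := E) J.contMDiff hX

end IsSmoothField

namespace EndomorphismField

/-- The field of endomorphisms `a J + b`, for constants `a` and `b`. -/
noncomputable def smulAddConst (J : EndomorphismField I M) (a b : ℝ) : EndomorphismField I M where
  toFun x := a • J.toFun x + b • ContinuousLinearMap.id ℝ (TangentSpace I x)
  contMDiff := by
    refine (J.contMDiff.const_smul_section (a := a)).add_section
      (ContMDiff.const_smul_section (a := b) fun x ↦ ?_)
    rw [contMDiffAt_section]
    refine (contMDiffAt_const (c := ContinuousLinearMap.id ℝ E)).congr_of_eventuallyEq ?_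
    filter_upwards [chart_source_mem_nhds H x] with y hy
    ext v
    exact (trivializationAt E (TangentSpace I : M → Type _) x).continuousLinearMapAt_symmL
      (by simpa using hy) v

variable (J : EndomorphismField I M) {p q : ℝ}

variable (p q) in
/-- The projection `𝒫` as a smooth field of endomorphisms. -/
noncomputable def projField : EndomorphismField I M :=
  J.smulAddConst (-(1 / √(p ^ 2 + 4 * q))) (((p + √(p ^ 2 + 4 * q)) / 2) / √(p ^ 2 + 4 * q))

variable (p q) in
/-- The projection `𝒫'` as a smooth field of endomorphisms. -/
noncomputable def projField' : EndomorphismField I M :=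
  J.smulAddConst (1 / √(p ^ 2 + 4 * q)) (-(((p - √(p ^ 2 + 4 * q)) / 2) / √(p ^ 2 + 4 * q)))

lemma projField_toFun : (J.projField p q).toFun = J.proj p q :=
  rfl

lemma projField'_toFun : (J.projField' p q).toFun = J.proj' p q := by
  ext x v
  simp [projField', smulAddConst, proj', sub_eq_add_neg]

variable {J}

lemma isSmoothField_proj {X : Π x : M, TangentSpace I x} (hX : IsSmoothField I X) :
    IsSmoothField I (applyField (J.proj p q) X) := by
  rw [← projField_toFun]
  exact hX.applyField _

lemma isSmoothField_proj' {X : Π x : M, TangentSpace I x} (hX : IsSmoothField I X) :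
    IsSmoothField I (applyField (J.proj' p q) X) := by
  rw [← projField'_toFun]
  exact hX.applyField _

variable {g : PseudoRiemannianMetric I M} (hJ : J.IsMetallic g p q) (hpq : 0 < p ^ 2 + 4 * q)
include hpq

lemma proj_add_proj' (x : M) (v : TangentSpace I x) :
    J.proj p q x v + J.proj' p q x v = v := by
  have hs : √(p ^ 2 + 4 * q) ≠ 0 := (Real.sqrt_pos.2 hpq).ne'
  simp only [proj, proj', add_apply, sub_apply, smul_apply, ContinuousLinearMap.id_apply]
  match_scalars <;> field_simp <;> ring

lemma toFun_eq_proj (x : M) (v : TangentSpace I x) :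
    J.toFun x v = ((p - √(p ^ 2 + 4 * q)) / 2) • J.proj p q x v
      + ((p + √(p ^ 2 + 4 * q)) / 2) • J.proj' p q x v := by
  have hs : √(p ^ 2 + 4 * q) ≠ 0 := (Real.sqrt_pos.2 hpq).ne'
  simp only [proj, proj', add_apply, sub_apply, smul_apply, ContinuousLinearMap.id_apply]
  match_scalars <;> field_simp <;> ring

lemma eq_applyField_add (X : Π x : M, TangentSpace I x) :
    X = (1 : ℝ) • applyField (J.proj p q) X + (1 : ℝ) • applyField (J.proj' p q) X := by
  ext x
  simpa [applyField] using (proj_add_proj' hpq x (X x)).symm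

lemma applyField_toFun_eq (X : Π x : M, TangentSpace I x) :
    applyField J.toFun X = ((p - √(p ^ 2 + 4 * q)) / 2) • applyField (J.proj p q) X
      + ((p + √(p ^ 2 + 4 * q)) / 2) • applyField (J.proj' p q) X := by
  ext x
  exact toFun_eq_proj hpq x (X x)

include hJ

lemma proj_proj' (x : M) (v : TangentSpace I x) : J.proj p q x (J.proj' p q x v) = 0 := by
  have hs : √(p ^ 2 + 4 * q) ≠ 0 := (Real.sqrt_pos.2 hpq).ne'
  have h2 : √(p ^ 2 + 4 * q) ^ 2 = p ^ 2 + 4 * q := Real.sq_sqrt hpq.le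
  simp only [proj, proj', add_apply, sub_apply, smul_apply, ContinuousLinearMap.id_apply,
    map_sub, map_smul, hJ.sq_eq]
  generalize √(p ^ 2 + 4 * q) = s at *
  match_scalars
  · field_simp
    ring
  · field_simp
    linear_combination h2

lemma proj'_proj (x : M) (v : TangentSpace I x) : J.proj' p q x (J.proj p q x v) = 0 := by
  have hs : √(p ^ 2 + 4 * q) ≠ 0 := (Real.sqrt_pos.2 hpq).ne'
  have h2 : √(p ^ 2 + 4 * q) ^ 2 = p ^ 2 + 4 * q := Real.sq_sqrt hpq.le
  simp only [proj, proj', add_apply, sub_apply, smul_apply, ContinuousLinearMap.id_apply,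
    map_add, map_smul, hJ.sq_eq]
  generalize √(p ^ 2 + 4 * q) = s at *
  match_scalars
  · field_simp
    ring
  · field_simp
    linear_combination h2

lemma proj_proj (x : M) (v : TangentSpace I x) :
    J.proj p q x (J.proj p q x v) = J.proj p q x v := by
  have := congr(J.proj p q x $(proj_add_proj' (J := J) hpq x v))
  rwa [map_add, proj_proj' hJ hpq, add_zero] at this

lemma proj'_proj' (x : M) (v : TangentSpace I x) :
    J.proj' p q x (J.proj' p q x v) = J.proj' p q x v := by
  have := congr(J.proj' p q x $(proj_add_proj' (J := J) hpq x v))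
  rwa [map_add, proj'_proj hJ hpq, zero_add] at this

lemma proj'_add_proj_eq_zero_iff {x : M}
    (v w : TangentSpace I x) :
    J.proj' p q x v + J.proj p q x w = 0 ↔ J.proj' p q x v = 0 ∧ J.proj p q x w = 0 := by
  refine ⟨fun h ↦ ?_, fun h ↦ by rw [h.1, h.2, add_zero]⟩
  have h1 := congr(J.proj' p q x $h)
  have h2 := congr(J.proj p q x $h)
  rw [map_add, proj'_proj' hJ hpq, proj'_proj hJ hpq, add_zero, map_zero] at h1
  rw [map_add, proj_proj' hJ hpq, proj_proj hJ hpq, zero_add, map_zero] at h2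
  exact ⟨h1, h2⟩

end EndomorphismField
end Algebra

section Brackets

variable {E : Type*} [NormedAddCommGroup E] [NormedSpace ℝ E] [CompleteSpace E]
  {H : Type*} [TopologicalSpace H] {I : ModelWithCorners ℝ E H}
  {M : Type*} [TopologicalSpace M] [ChartedSpace H M] [IsManifold I ∞ M]

variable (I) in
/-- The image of the field of endomorphisms `P` is involutive modulo the kernel of `Q`:
`Q [P X, P Y] = 0` for all smooth vector fields. For complementary projections `P`, `Q` this says
that the distribution `ker Q` is involutive. -/
def IsInvolutive (P Q : Π x : M, TangentSpace I x →L[ℝ] TangentSpace I x) : Prop :=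
  VanishesOnSmooth I fun X Y ↦ applyField Q (mlieBracket I (applyField P X) (applyField P Y))

lemma mlieBracket_add_smul_add_smul {X₁ X₂ Y₁ Y₂ : Π x : M, TangentSpace I x}
    (hX₁ : IsSmoothField I X₁) (hX₂ : IsSmoothField I X₂)
    (hY₁ : IsSmoothField I Y₁) (hY₂ : IsSmoothField I Y₂) (a b c d : ℝ) (x : M) :
    mlieBracket I (a • X₁ + b • X₂) (c • Y₁ + d • Y₂) x =
      (a * c) • mlieBracket I X₁ Y₁ x + (a * d) • mlieBracket I X₁ Y₂ x
        + (b * c) • mlieBracket I X₂ Y₁ x + (b * d) • mlieBracket I X₂ Y₂ x := by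
  rw [mlieBracket_add_left ((hX₁.const_smul a).mdifferentiableAt x)
      ((hX₂.const_smul b).mdifferentiableAt x),
    mlieBracket_const_smul_left (hX₁.mdifferentiableAt x),
    mlieBracket_const_smul_left (hX₂.mdifferentiableAt x),
    mlieBracket_add_right ((hY₁.const_smul c).mdifferentiableAt x)
      ((hY₂.const_smul d).mdifferentiableAt x),
    mlieBracket_add_right ((hY₁.const_smul c).mdifferentiableAt x)
      ((hY₂.const_smul d).mdifferentiableAt x),
    mlieBracket_const_smul_right (hY₁.mdifferentiableAt x),
    mlieBracket_const_smul_right (hY₁.mdifferentiableAt x),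
    mlieBracket_const_smul_right (hY₂.mdifferentiableAt x),
    mlieBracket_const_smul_right (hY₂.mdifferentiableAt x)]
  module

namespace EndomorphismField

variable {J : EndomorphismField I M} {p q : ℝ} {g : PseudoRiemannianMetric I M}
  {X Y : Π x : M, TangentSpace I x}

lemma mlieBracket_eq_sum (hpq : 0 < p ^ 2 + 4 * q)
    (hX : IsSmoothField I X) (hY : IsSmoothField I Y) (x : M) :
    mlieBracket I X Y x =
      mlieBracket I (applyField (J.proj p q) X) (applyField (J.proj p q) Y) x
      + mlieBracket I (applyField (J.proj p q) X) (applyField (J.proj' p q) Y) x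
      + mlieBracket I (applyField (J.proj' p q) X) (applyField (J.proj p q) Y) x
      + mlieBracket I (applyField (J.proj' p q) X) (applyField (J.proj' p q) Y) x := by
  have e := mlieBracket_add_smul_add_smul (isSmoothField_proj (J := J) (p := p) (q := q) hX)
    (isSmoothField_proj' (J := J) (p := p) (q := q) hX)
    (isSmoothField_proj (J := J) (p := p) (q := q) hY)
    (isSmoothField_proj' (J := J) (p := p) (q := q) hY) 1 1 1 1 x
  rw [← eq_applyField_add (J := J) hpq X, ← eq_applyField_add (J := J) hpq Y] at e
  rw [e]
  module

/-- The Nijenhuis tensor measures the two obstructions `𝒫'[𝒫X, 𝒫Y]` and `𝒫[𝒫'X, 𝒫'Y]`: its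
values on mixed pairs vanish identically. -/
lemma nijenhuis_eq (hJ : J.IsMetallic g p q) (hpq : 0 < p ^ 2 + 4 * q)
    (hX : IsSmoothField I X) (hY : IsSmoothField I Y) (x : M) :
    J.nijenhuis X Y x = -(p ^ 2 + 4 * q) •
      (J.proj' p q x (mlieBracket I (applyField (J.proj p q) X) (applyField (J.proj p q) Y) x)
      + J.proj p q x
        (mlieBracket I (applyField (J.proj' p q) X) (applyField (J.proj' p q) Y) x)) := by
  have e := mlieBracket_add_smul_add_smul (isSmoothField_proj (J := J) (p := p) (q := q) hX)
    (isSmoothField_proj' (J := J) (p := p) (q := q) hX)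
    (isSmoothField_proj (J := J) (p := p) (q := q) hY)
    (isSmoothField_proj' (J := J) (p := p) (q := q) hY)
  have h1 : J.nijenhuis X Y x = J.toFun x (mlieBracket I (applyField J.toFun X) Y x
      + mlieBracket I X (applyField J.toFun Y) x - J.toFun x (mlieBracket I X Y x))
      - mlieBracket I (applyField J.toFun X) (applyField J.toFun Y) x := rfl
  have e₁ := e ((p - √(p ^ 2 + 4 * q)) / 2) ((p + √(p ^ 2 + 4 * q)) / 2) 1 1 x
  have e₂ := e 1 1 ((p - √(p ^ 2 + 4 * q)) / 2) ((p + √(p ^ 2 + 4 * q)) / 2) x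
  have e₃ := e ((p - √(p ^ 2 + 4 * q)) / 2) ((p + √(p ^ 2 + 4 * q)) / 2)
    ((p - √(p ^ 2 + 4 * q)) / 2) ((p + √(p ^ 2 + 4 * q)) / 2) x
  rw [← applyField_toFun_eq (J := J) hpq X, ← eq_applyField_add (J := J) hpq Y] at e₁
  rw [← applyField_toFun_eq (J := J) hpq Y, ← eq_applyField_add (J := J) hpq X] at e₂
  rw [← applyField_toFun_eq (J := J) hpq X, ← applyField_toFun_eq (J := J) hpq Y] at e₃
  have hs : √(p ^ 2 + 4 * q) ^ 2 = p ^ 2 + 4 * q := Real.sq_sqrt hpq.le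
  have hJ' := toFun_eq_proj (J := J) hpq x
  rw [h1, e₁, e₂, e₃, mlieBracket_eq_sum (J := J) hpq hX hY x]
  generalize mlieBracket I (applyField (J.proj p q) X) (applyField (J.proj p q) Y) x = b₁₁
  generalize mlieBracket I (applyField (J.proj p q) X) (applyField (J.proj' p q) Y) x = b₁₂
  generalize mlieBracket I (applyField (J.proj' p q) X) (applyField (J.proj p q) Y) x = b₂₁
  generalize mlieBracket I (applyField (J.proj' p q) X) (applyField (J.proj' p q) Y) x = b₂₂
  have h₁₁ := proj_add_proj' (J := J) hpq x b₁₁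
  have h₁₂ := proj_add_proj' (J := J) hpq x b₁₂
  have h₂₁ := proj_add_proj' (J := J) hpq x b₂₁
  have h₂₂ := proj_add_proj' (J := J) hpq x b₂₂
  simp only [hJ', map_add, map_sub, map_smul, proj_proj hJ hpq, proj_proj' hJ hpq,
    proj'_proj hJ hpq, proj'_proj' hJ hpq]
  generalize √(p ^ 2 + 4 * q) = s at *
  rw [← hs]
  linear_combination (norm := module) ((p - s) / 2 * ((p - s) / 2)) • h₁₁
    + ((p - s) / 2 * ((p + s) / 2)) • h₁₂ + ((p - s) / 2 * ((p + s) / 2)) • h₂₁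
    + ((p + s) / 2 * ((p + s) / 2)) • h₂₂

omit [CompleteSpace E] in
/-- Any smooth bilinear expression which is a nonzero multiple of
`𝒫'[𝒫X, 𝒫Y] + 𝒫[𝒫'X, 𝒫'Y]` vanishes if and only if both metallic distributions are involutive. -/
lemma vanishesOnSmooth_iff (hJ : J.IsMetallic g p q) (hpq : 0 < p ^ 2 + 4 * q)
    {B : (Π x : M, TangentSpace I x) → (Π x : M, TangentSpace I x) → Π x : M, TangentSpace I x}
    {c : ℝ} (hc : c ≠ 0)
    (hB : ∀ {X Y : Π x : M, TangentSpace I x}, IsSmoothField I X → IsSmoothField I Y → ∀ x,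
      B X Y x = c •
        (J.proj' p q x (mlieBracket I (applyField (J.proj p q) X) (applyField (J.proj p q) Y) x)
        + J.proj p q x
          (mlieBracket I (applyField (J.proj' p q) X) (applyField (J.proj' p q) Y) x))) :
    VanishesOnSmooth I B ↔
      IsInvolutive I (J.proj p q) (J.proj' p q) ∧ IsInvolutive I (J.proj' p q) (J.proj p q) := by
  have key {X Y : Π x : M, TangentSpace I x} (hX : IsSmoothField I X) (hY : IsSmoothField I Y)
      (x : M) : B X Y x = 0 ↔
        J.proj' p q x (mlieBracket I (applyField (J.proj p q) X) (applyField (J.proj p q) Y) x) = 0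
        ∧ J.proj p q x
          (mlieBracket I (applyField (J.proj' p q) X) (applyField (J.proj' p q) Y) x) = 0 := by
    rw [hB hX hY, smul_eq_zero_iff_right hc, proj'_add_proj_eq_zero_iff hJ hpq]
  refine ⟨fun h ↦ ⟨fun X Y hX hY ↦ ?_, fun X Y hX hY ↦ ?_⟩, fun h X Y hX hY ↦ ?_⟩
  · ext x
    exact ((key hX hY x).1 (congrFun (h X Y hX hY) x)).1
  · ext x
    exact ((key hX hY x).1 (congrFun (h X Y hX hY) x)).2
  · ext x
    exact (key hX hY x).2 ⟨congrFun (h.1 X Y hX hY) x, congrFun (h.2 X Y hX hY) x⟩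

lemma vanishesOnSmooth_nijenhuis_iff (hJ : J.IsMetallic g p q) (hpq : 0 < p ^ 2 + 4 * q) :
    VanishesOnSmooth I J.nijenhuis ↔
      IsInvolutive I (J.proj p q) (J.proj' p q) ∧ IsInvolutive I (J.proj' p q) (J.proj p q) :=
  vanishesOnSmooth_iff hJ hpq (neg_ne_zero.2 hpq.ne') (nijenhuis_eq hJ hpq)

section LeviCivita

variable [FiniteDimensional ℝ E]

lemma leviCivita_sub_leviCivita (hX : IsSmoothField I X) (hY : IsSmoothField I Y) (x : M) :
    g.leviCivita Y x (X x) - g.leviCivita X x (Y x) = mlieBracket I X Y x :=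
  ((CovariantDerivative.torsion_eq_zero_iff _).1 g.leviCivita_isLeviCivita.torsion_eq_zero)
    (hX.mdifferentiableAt x) (hY.mdifferentiableAt x)

lemma twisting_eq (hX : IsSmoothField I X) (hY : IsSmoothField I Y) (x : M) :
    J.twisting g p q X Y x = (1 / 2 : ℝ) • J.proj' p q x
      (mlieBracket I (applyField (J.proj p q) X) (applyField (J.proj p q) Y) x) := by
  rw [← leviCivita_sub_leviCivita (g := g) (isSmoothField_proj hX) (isSmoothField_proj hY), map_sub]
  rfl

lemma twisting'_eq (hX : IsSmoothField I X) (hY : IsSmoothField I Y) (x : M) :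
    J.twisting' g p q X Y x = (1 / 2 : ℝ) • J.proj p q x
      (mlieBracket I (applyField (J.proj' p q) X) (applyField (J.proj' p q) Y) x) := by
  rw [← leviCivita_sub_leviCivita (g := g) (isSmoothField_proj' hX) (isSmoothField_proj' hY),
    map_sub]
  rfl

lemma vidal_eq (hJ : J.IsMetallic g p q) (hpq : 0 < p ^ 2 + 4 * q)
    (X Y : Π x : M, TangentSpace I x) (x : M) :
    J.vidal g p q X Y x =
      J.proj p q x (g.leviCivita (applyField (J.proj p q) Y) x (X x))
      + J.proj' p q x (g.leviCivita (applyField (J.proj' p q) Y) x (X x))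
      - J.proj p q x (g.leviCivita (applyField (J.proj' p q) X) x (J.proj p q x (Y x)))
      - J.proj' p q x (g.leviCivita (applyField (J.proj p q) X) x (J.proj' p q x (Y x))) := by
  have h : J.vidal g p q X Y x =
      J.proj p q x (g.leviCivita (applyField (J.proj p q) Y) x (X x))
      + J.proj' p q x (g.leviCivita (applyField (J.proj' p q) Y) x (X x))
      - J.proj p q x (g.leviCivita (applyField (J.proj' p q) X) x (J.proj p q x (Y x))
        - J.proj' p q x (g.leviCivita X x (J.proj p q x (Y x))))
      - J.proj' p q x (g.leviCivita (applyField (J.proj p q) X) x (J.proj' p q x (Y x))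
        - J.proj p q x (g.leviCivita X x (J.proj' p q x (Y x)))) := rfl
  rw [h, map_sub, map_sub, proj_proj' hJ hpq, proj'_proj hJ hpq, sub_zero, sub_zero]

/-- The torsion of the Vidal connection, like the Nijenhuis tensor, measures the two obstructions
`𝒫'[𝒫X, 𝒫Y]` and `𝒫[𝒫'X, 𝒫'Y]`. -/
lemma torsionOf_vidal_eq (hJ : J.IsMetallic g p q) (hpq : 0 < p ^ 2 + 4 * q)
    (hX : IsSmoothField I X) (hY : IsSmoothField I Y) (x : M) :
    torsionOf (J.vidal g p q) X Y x = -
      (J.proj' p q x (mlieBracket I (applyField (J.proj p q) X) (applyField (J.proj p q) Y) x)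
      + J.proj p q x
        (mlieBracket I (applyField (J.proj' p q) X) (applyField (J.proj' p q) Y) x)) := by
  have hPX := isSmoothField_proj (J := J) (p := p) (q := q) hX
  have hPY := isSmoothField_proj (J := J) (p := p) (q := q) hY
  have hQX := isSmoothField_proj' (J := J) (p := p) (q := q) hX
  have hQY := isSmoothField_proj' (J := J) (p := p) (q := q) hY
  have h : torsionOf (J.vidal g p q) X Y x =
    J.vidal g p q X Y x - J.vidal g p q Y X x - mlieBracket I X Y x := rfl
  have h₁₁ := leviCivita_sub_leviCivita (g := g) hPX hPY x
  have h₁₂ := leviCivita_sub_leviCivita (g := g) hPX hQY x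
  have h₂₁ := leviCivita_sub_leviCivita (g := g) hQX hPY x
  have h₂₂ := leviCivita_sub_leviCivita (g := g) hQX hQY x
  have hXx := proj_add_proj' (J := J) hpq x (X x)
  have hYx := proj_add_proj' (J := J) hpq x (Y x)
  have hb := proj_add_proj' (J := J) hpq x (mlieBracket I X Y x)
  rw [h, ← hb, vidal_eq hJ hpq, vidal_eq hJ hpq, mlieBracket_eq_sum (J := J) hpq hX hY x,
    ← h₁₁, ← h₁₂, ← h₂₁, ← h₂₂]
  -- Only the values of `X` and `Y` at `x` enter the directions of differentiation.
  simp only [applyField]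
  generalize J.proj p q x (X x) = a at *
  generalize J.proj' p q x (X x) = a' at *
  generalize J.proj p q x (Y x) = b at *
  generalize J.proj' p q x (Y x) = b' at *
  rw [← hXx, ← hYx]
  simp only [map_add, map_sub]
  abel

lemma vanishesOnSmooth_torsionOf_vidal_iff (hJ : J.IsMetallic g p q) (hpq : 0 < p ^ 2 + 4 * q) :
    VanishesOnSmooth I (torsionOf (J.vidal g p q)) ↔
      IsInvolutive I (J.proj p q) (J.proj' p q) ∧ IsInvolutive I (J.proj' p q) (J.proj p q) :=
  vanishesOnSmooth_iff hJ hpq (c := -1) (by simp) fun hX hY x ↦ by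
    rw [torsionOf_vidal_eq hJ hpq hX hY, neg_one_smul]

lemma vanishesOnSmooth_twisting_iff :
    VanishesOnSmooth I (J.twisting g p q) ↔ IsInvolutive I (J.proj p q) (J.proj' p q) := by
  refine forall₄_congr fun X Y hX hY ↦ ?_
  simp [funext_iff, twisting_eq hX hY, applyField]

lemma vanishesOnSmooth_twisting'_iff :
    VanishesOnSmooth I (J.twisting' g p q) ↔ IsInvolutive I (J.proj' p q) (J.proj p q) := by
  refine forall₄_congr fun X Y hX hY ↦ ?_
  simp [funext_iff, twisting'_eq hX hY, applyField]

end LeviCivita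
end EndomorphismField
end Brackets

/-! ### Vector fields and fields of endomorphisms in a chart -/

section InChart

open Set Filter Topology

variable {E : Type*} [NormedAddCommGroup E] [NormedSpace ℝ E]
  {H : Type*} [TopologicalSpace H] {I : ModelWithCorners ℝ E H}
  {M : Type*} [TopologicalSpace M] [ChartedSpace H M] [IsManifold I ∞ M]

variable (I) in
/-- The differential at `x` of the preferred chart at `x₀`. -/
noncomputable def chartDeriv (x₀ x : M) : TangentSpace I x →L[ℝ] E :=
  mfderiv I 𝓘(ℝ, E) (extChartAt I x₀) x

variable (I) in
/-- The differential at `z` of the inverse of the preferred chart at `x₀`. -/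
noncomputable def chartSymmDeriv (x₀ : M) (z : E) :
    E →L[ℝ] TangentSpace I ((extChartAt I x₀).symm z) :=
  mfderiv 𝓘(ℝ, E) I (extChartAt I x₀).symm z

/-- A vector field read in the preferred chart at `x₀`. -/
noncomputable def fieldInChart (x₀ : M) (X : Π x : M, TangentSpace I x) (z : E) : E :=
  chartDeriv I x₀ _ (X ((extChartAt I x₀).symm z))

/-- A field of endomorphisms read in the preferred chart at `x₀`. -/
noncomputable def endoInChart (x₀ : M) (A : Π x : M, TangentSpace I x →L[ℝ] TangentSpace I x)
    (z : E) : E →L[ℝ] E :=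
  chartDeriv I x₀ _ ∘L A ((extChartAt I x₀).symm z) ∘L chartSymmDeriv I x₀ z

variable {x₀ : M} {z : E}

omit [IsManifold I ∞ M] in
lemma endoInChart_apply (A : Π x : M, TangentSpace I x →L[ℝ] TangentSpace I x) (v : E) :
    endoInChart x₀ A z v = chartDeriv I x₀ _ (A _ (chartSymmDeriv I x₀ z v)) :=
  rfl

lemma continuousLinearMapAt_eq_chartDeriv {x : M} (hx : x ∈ (chartAt H x₀).source) :
    (trivializationAt E (TangentSpace I) x₀).continuousLinearMapAt ℝ x = chartDeriv I x₀ x :=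
  TangentBundle.continuousLinearMapAt_trivializationAt hx

lemma contDiffOn_fieldInChart {X : Π x : M, TangentSpace I x} (hX : IsSmoothField I X) :
    ContDiffOn ℝ ∞ (fieldInChart x₀ X) (extChartAt I x₀).target := by
  set t := trivializationAt E (TangentSpace I : M → Type _) x₀ with ht
  have h1 : ContMDiffOn I 𝓘(ℝ, E) ∞ (fun x ↦ (t ⟨x, X x⟩).2) (chartAt H x₀).source := by
    intro x hx
    exact (t.contMDiffWithinAt_section _ (by simpa [ht] using hx)).1 (hX x).contMDiffWithinAt
  rw [← contMDiffOn_iff_contDiffOn]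
  refine (h1.comp (contMDiffOn_extChartAt_symm x₀) fun z hz ↦ ?_).congr fun z hz ↦ ?_
  · simpa using (extChartAt I x₀).map_target hz
  · have hz' : (extChartAt I x₀).symm z ∈ (chartAt H x₀).source := by
      simpa using (extChartAt I x₀).map_target hz
    rw [fieldInChart, ← continuousLinearMapAt_eq_chartDeriv hz', Function.comp,
      Trivialization.continuousLinearMapAt_apply, Trivialization.linearMapAt_apply, if_pos]
    simpa [ht] using hz'

variable [I.Boundaryless]

lemma symmL_eq_chartSymmDeriv (hz : z ∈ (extChartAt I x₀).target) :
    (trivializationAt E (TangentSpace I) x₀).symmL ℝ ((extChartAt I x₀).symm z)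
      = chartSymmDeriv I x₀ z := by
  have hz' : (extChartAt I x₀).symm z ∈ (chartAt H x₀).source := by
    simpa using (extChartAt I x₀).map_target hz
  have := TangentBundle.symmL_trivializationAt (I := I) (𝕜 := ℝ) hz'
  rw [(extChartAt I x₀).right_inv hz, ModelWithCorners.Boundaryless.range_eq_univ,
    mfderivWithin_univ] at this
  exact this

lemma chartDeriv_chartSymmDeriv (hz : z ∈ (extChartAt I x₀).target) (v : E) :
    chartDeriv I x₀ _ (chartSymmDeriv I x₀ z v) = v := by
  have := mfderiv_extChartAt_comp_mfderivWithin_extChartAt_symm (I := I) hz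
  rw [ModelWithCorners.Boundaryless.range_eq_univ, mfderivWithin_univ] at this
  exact congr($this v)

lemma chartSymmDeriv_chartDeriv (hz : z ∈ (extChartAt I x₀).target)
    (v : TangentSpace I ((extChartAt I x₀).symm z)) :
    chartSymmDeriv I x₀ z (chartDeriv I x₀ _ v) = v := by
  have := mfderivWithin_extChartAt_symm_comp_mfderiv_extChartAt (I := I) hz
  rw [ModelWithCorners.Boundaryless.range_eq_univ, mfderivWithin_univ] at this
  exact congr($this v)

lemma contDiffOn_endoInChart (J : EndomorphismField I M) :
    ContDiffOn ℝ ∞ (endoInChart x₀ J.toFun) (extChartAt I x₀).target := by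
  set t := trivializationAt (E →L[ℝ] E)
    (fun x : M ↦ TangentSpace I x →L[ℝ] TangentSpace I x) x₀ with ht
  have h1 : ContMDiffOn I 𝓘(ℝ, E →L[ℝ] E) ∞ (fun x ↦ (t ⟨x, J.toFun x⟩).2)
      (chartAt H x₀).source := by
    intro x hx
    refine (t.contMDiffWithinAt_section _ ?_).1 (J.contMDiff x).contMDiffWithinAt
    simpa [ht, hom_trivializationAt] using hx
  rw [← contMDiffOn_iff_contDiffOn]
  refine (h1.comp (contMDiffOn_extChartAt_symm x₀) fun z hz ↦ ?_).congr fun z hz ↦ ?_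
  · simpa using (extChartAt I x₀).map_target hz
  · have hz' : (extChartAt I x₀).symm z ∈ (chartAt H x₀).source := by
      simpa using (extChartAt I x₀).map_target hz
    rw [endoInChart, ← continuousLinearMapAt_eq_chartDeriv hz', ← symmL_eq_chartSymmDeriv hz]
    rfl

lemma endoInChart_fieldInChart (A : Π x : M, TangentSpace I x →L[ℝ] TangentSpace I x)
    (X : Π x : M, TangentSpace I x) (hz : z ∈ (extChartAt I x₀).target) :
    endoInChart x₀ A z (fieldInChart x₀ X z) = fieldInChart x₀ (applyField A X) z := by
  rw [endoInChart_apply, fieldInChart, chartSymmDeriv_chartDeriv hz]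
  rfl

lemma endoInChart_eq_zero_iff (A : Π x : M, TangentSpace I x →L[ℝ] TangentSpace I x)
    (hz : z ∈ (extChartAt I x₀).target) (v : E) :
    endoInChart x₀ A z v = 0 ↔ A _ (chartSymmDeriv I x₀ z v) = 0 := by
  refine ⟨fun h ↦ ?_, fun h ↦ by rw [endoInChart_apply, h, map_zero]⟩
  rw [← chartSymmDeriv_chartDeriv hz (A _ (chartSymmDeriv I x₀ z v))]
  exact (congrArg (chartSymmDeriv I x₀ z) h).trans (map_zero _)

lemma mpullback_extChartAt_symm_apply (X : Π x : M, TangentSpace I x)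
    (hz : z ∈ (extChartAt I x₀).target) :
    mpullback 𝓘(ℝ, E) I (extChartAt I x₀).symm X z = fieldInChart x₀ X z := by
  have h : chartSymmDeriv I x₀ z (fieldInChart x₀ X z) = X _ := chartSymmDeriv_chartDeriv hz _
  have hinv : (mfderiv 𝓘(ℝ, E) I (extChartAt I x₀).symm z).IsInvertible := by
    have := isInvertible_mfderivWithin_extChartAt_symm (I := I) hz
    rwa [ModelWithCorners.Boundaryless.range_eq_univ, mfderivWithin_univ] at this
  rw [mpullback_apply, ← h]
  exact hinv.inverse_apply_self _

/-- The Lie bracket of vector fields is computed in a chart. -/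
lemma fieldInChart_mlieBracket [CompleteSpace E] {X Y : Π x : M, TangentSpace I x}
    (hX : IsSmoothField I X) (hY : IsSmoothField I Y) (hz : z ∈ (extChartAt I x₀).target) :
    fieldInChart x₀ (mlieBracket I X Y) z =
      fderiv ℝ (fieldInChart x₀ Y) z (fieldInChart x₀ X z)
        - fderiv ℝ (fieldInChart x₀ X) z (fieldInChart x₀ Y z) := by
  have hn : (extChartAt I x₀).target ∈ 𝓝 z := (isOpen_extChartAt_target x₀).mem_nhds hz
  have hs : ContMDiffAt 𝓘(ℝ, E) I ∞ (extChartAt I x₀).symm z :=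
    (contMDiffOn_extChartAt_symm x₀).contMDiffAt hn
  have hX' : mpullback 𝓘(ℝ, E) I (extChartAt I x₀).symm X =ᶠ[𝓝 z] fieldInChart x₀ X := by
    filter_upwards [hn] with w hw using mpullback_extChartAt_symm_apply X hw
  have hY' : mpullback 𝓘(ℝ, E) I (extChartAt I x₀).symm Y =ᶠ[𝓝 z] fieldInChart x₀ Y := by
    filter_upwards [hn] with w hw using mpullback_extChartAt_symm_apply Y hw
  have : IsManifold I (minSmoothness ℝ 2) M := by
    rw [minSmoothness_of_isRCLikeNormedField]
    exact .of_le (n := ∞) ENat.LEInfty.out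
  rw [← mpullback_extChartAt_symm_apply _ hz, mpullback_mlieBracket (n := ∞)
    (hX.mdifferentiableAt _) (hY.mdifferentiableAt _) hs
      (by rw [minSmoothness_of_isRCLikeNormedField]; exact ENat.LEInfty.out),
    hX'.mlieBracket_vectorField_eq hY']
  have h := mlieBracketWithin_eq_lieBracketWithin (𝕜 := ℝ) (V := fieldInChart x₀ X)
    (W := fieldInChart x₀ Y) (s := univ)
  rw [lieBracketWithin_univ] at h
  exact congrFun h z

/-- For vector fields annihilated by `A`, the value of `A` on their bracket only depends on the
values of the fields at the point: it is the antisymmetrised differential of `A`. -/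
lemma fieldInChart_applyField_mlieBracket [CompleteSpace E]
    {A : Π x : M, TangentSpace I x →L[ℝ] TangentSpace I x} {X Y : Π x : M, TangentSpace I x}
    (hX : IsSmoothField I X) (hY : IsSmoothField I Y) (hAX : applyField A X = 0)
    (hAY : applyField A Y = 0) (hz : z ∈ (extChartAt I x₀).target)
    (hA : DifferentiableAt ℝ (endoInChart x₀ A) z) :
    fieldInChart x₀ (applyField A (mlieBracket I X Y)) z =
      fderiv ℝ (endoInChart x₀ A) z (fieldInChart x₀ Y z) (fieldInChart x₀ X z)
        - fderiv ℝ (endoInChart x₀ A) z (fieldInChart x₀ X z) (fieldInChart x₀ Y z) := by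
  have hn : (extChartAt I x₀).target ∈ 𝓝 z := (isOpen_extChartAt_target x₀).mem_nhds hz
  have key {W : Π x : M, TangentSpace I x} (hW : IsSmoothField I W) (hAW : applyField A W = 0)
      (v : E) : fderiv ℝ (endoInChart x₀ A) z v (fieldInChart x₀ W z)
        = - endoInChart x₀ A z (fderiv ℝ (fieldInChart x₀ W) z v) := by
    have hWd : DifferentiableAt ℝ (fieldInChart x₀ W) z :=
      ((contDiffOn_fieldInChart hW).contDiffAt hn).differentiableAt (by simp)
    have h0 : (fun w ↦ endoInChart x₀ A w (fieldInChart x₀ W w)) =ᶠ[𝓝 z] fun _ ↦ 0 := by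
      filter_upwards [hn] with w hw
      rw [endoInChart_fieldInChart A W hw, hAW]
      exact map_zero _
    have h1 := fderiv_clm_apply hA hWd
    rw [h0.fderiv_eq] at h1
    have h2 := congr($h1 v)
    simp only [fderiv_fun_const, Pi.zero_apply, zero_apply, add_apply,
      ContinuousLinearMap.comp_apply, ContinuousLinearMap.flip_apply] at h2
    rw [eq_neg_iff_add_eq_zero, add_comm]
    exact h2.symm
  rw [← endoInChart_fieldInChart _ _ hz, fieldInChart_mlieBracket hX hY hz, map_sub, key hX hAX,
    key hY hAY]
  abel

end InChart

/-! ### Leaves of the kernel of a field of projections in a Banach space -/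

section Leaf

open Metric Set Filter Topology

variable {E : Type*} [NormedAddCommGroup E] [NormedSpace ℝ E]

/-- If the differential of a parametrised submanifold `c` takes values in the kernel of `A`, then
the antisymmetrised differential of `A` vanishes on its tangent vectors, by the symmetry of the
second differential of `c`. -/
lemma fderiv_symm_of_comp_fderiv_eq_zero {V : Type*} [NormedAddCommGroup V] [NormedSpace ℝ V]
    {A : E → E →L[ℝ] E} {c : V → E} {u₀ : V}
    (hA : DifferentiableAt ℝ A (c u₀)) (hc : ContDiffAt ℝ 2 c u₀)
    (h : ∀ᶠ u in 𝓝 u₀, ∀ a, A (c u) (fderiv ℝ c u a) = 0) (a b : V) :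
    fderiv ℝ A (c u₀) (fderiv ℝ c u₀ a) (fderiv ℝ c u₀ b) =
      fderiv ℝ A (c u₀) (fderiv ℝ c u₀ b) (fderiv ℝ c u₀ a) := by
  have hcd : HasFDerivAt c (fderiv ℝ c u₀) u₀ :=
    (hc.differentiableAt (by norm_num)).hasFDerivAt
  have hc' : DifferentiableAt ℝ (fderiv ℝ c) u₀ :=
    (hc.fderiv_right (m := 1) (by norm_num)).differentiableAt (by norm_num)
  have hsymm : IsSymmSndFDerivAt ℝ c u₀ :=
    hc.isSymmSndFDerivAt (by rw [minSmoothness_of_isRCLikeNormedField])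
  have key (a b : V) : fderiv ℝ A (c u₀) (fderiv ℝ c u₀ a) (fderiv ℝ c u₀ b) =
      -A (c u₀) (fderiv ℝ (fderiv ℝ c) u₀ a b) := by
    have h1 : HasFDerivAt (fun u ↦ A (c u)) (fderiv ℝ A (c u₀) ∘L fderiv ℝ c u₀) u₀ :=
      hA.hasFDerivAt.comp u₀ hcd
    have h2 := h1.clm_apply (hc'.hasFDerivAt.clm_apply (hasFDerivAt_const b u₀))
    have h3 : (fun u ↦ A (c u) (fderiv ℝ c u b)) =ᶠ[𝓝 u₀] fun _ ↦ 0 := h.mono fun u hu ↦ hu b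
    have h4 := congr($((h2.congr_of_eventuallyEq h3.symm).unique (hasFDerivAt_const 0 u₀)) a)
    simp only [ContinuousLinearMap.comp_zero, zero_add, add_apply, ContinuousLinearMap.comp_apply,
      ContinuousLinearMap.flip_apply, zero_apply] at h4
    rw [eq_neg_iff_add_eq_zero, add_comm]
    exact h4
  rw [key, key, hsymm.eq]

/-- The intertwiner `P₀ P + Q₀ Q` between the complementary projections `P = 1 - Q`, `Q` and
`P₀ = 1 - Q₀`, `Q₀`. -/
def projIntertwiner (Q₀ Q : E →L[ℝ] E) : E →L[ℝ] E :=
  (1 - Q₀) * (1 - Q) + Q₀ * Q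

lemma projIntertwiner_self {Q : E →L[ℝ] E} (h : Q * Q = Q) : projIntertwiner Q Q = 1 := by
  rw [projIntertwiner]
  linear_combination (norm := noncomm_ring) 2 • h

/-- A field of projections `Q` near `z₀` admits, for `V = ker (Q z₀)`, a smooth family of linear
parametrisations `F z` of `ker (Q z)` with a common left inverse `p`. -/
lemma exists_frame_ker [CompleteSpace E] {Q : E → E →L[ℝ] E} {U : Set E} (hU : IsOpen U)
    (hQ : ContDiffOn ℝ ∞ Q U) (hQQ : ∀ z ∈ U, Q z * Q z = Q z) {z₀ : E} (hz₀ : z₀ ∈ U) :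
    ∃ U' ⊆ U, IsOpen U' ∧ z₀ ∈ U' ∧ ∃ (F : E → LinearMap.ker (Q z₀).toLinearMap →L[ℝ] E)
      (p : E →L[ℝ] LinearMap.ker (Q z₀).toLinearMap), ContDiffOn ℝ ∞ F U' ∧
      (∀ z ∈ U', ∀ x, Q z (F z x) = 0) ∧ (∀ z ∈ U', ∀ x, p (F z x) = x) ∧
      ∀ z ∈ U', ∀ v, Q z v = 0 → F z (p v) = v := by
  set B : E → E →L[ℝ] E := fun z ↦ projIntertwiner (Q z₀) (Q z) with hB
  have hBs : ContDiffOn ℝ ∞ B U :=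
    (contDiffOn_const.mul (contDiffOn_const.sub hQ)).add (contDiffOn_const.mul hQ)
  have h₀ := hQQ z₀ hz₀
  have hU' : IsOpen (U ∩ B ⁻¹' {b | IsUnit b}) :=
    hBs.continuousOn.isOpen_inter_preimage hU Units.isOpen
  have hb {z : E} (hz : z ∈ U ∩ B ⁻¹' {b | IsUnit b}) (x : E) :
      Ring.inverse (B z) (B z x) = x :=
    congr($(Ring.inverse_mul_cancel _ hz.2) x)
  have hb' {z : E} (hz : z ∈ U ∩ B ⁻¹' {b | IsUnit b}) (x : E) :
      B z (Ring.inverse (B z) x) = x :=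
    congr($(Ring.mul_inverse_cancel _ hz.2) x)
  have hBker {z : E} {v : E} (hv : Q z v = 0) : B z v = v - Q z₀ v := by
    simp [hB, projIntertwiner, hv]
  -- `B z` intertwines the projections, hence so does its inverse.
  have hker {z : E} (hz : z ∈ U ∩ B ⁻¹' {b | IsUnit b}) {x : E} (hx : Q z₀ x = 0) :
      Q z (Ring.inverse (B z) x) = 0 := by
    have hc : Q z₀ * B z = B z * Q z := by
      have := hQQ z hz.1
      simp only [hB, projIntertwiner]
      linear_combination (norm := noncomm_ring)
        (2 : ℕ) • (h₀ * Q z) - h₀ + this - (2 : ℕ) • (Q z₀ * this)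
    have h1 := congr($hc (Ring.inverse (B z) x))
    simp only [mul_apply_eq_comp, hb' hz, hx] at h1
    rw [← hb hz (Q z (Ring.inverse (B z) x)), ← h1, map_zero]
  let K := LinearMap.ker (Q z₀).toLinearMap
  let p : E →L[ℝ] K := (1 - Q z₀).codRestrict K fun v ↦ by
    have := congr($h₀ v)
    simp only [mul_apply_eq_comp] at this
    simp [K, this]
  have hpv (v : E) : (p v : E) = v - Q z₀ v := rfl
  have hK (x : K) : Q z₀ x = 0 := x.2
  refine ⟨_, inter_subset_left, hU', ⟨hz₀, ?_⟩, fun z ↦ Ring.inverse (B z) ∘L K.subtypeL, p,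
    ?_, fun z hz x ↦ hker hz (hK x), fun z hz x ↦ ?_, fun z hz v hv ↦ ?_⟩
  · simp [hB, projIntertwiner_self h₀]
  · suffices hinv : ContDiffOn ℝ ∞ (fun z ↦ Ring.inverse (B z)) (U ∩ B ⁻¹' {b | IsUnit b}) from
      hinv.clm_comp contDiffOn_const
    intro z hz
    obtain ⟨b, hbz⟩ := hz.2
    have hi : ContDiffAt ℝ ∞ Ring.inverse (B z) := by
      rw [← hbz]
      exact contDiffAt_ringInverse ℝ b
    exact (hi.comp z (hBs.contDiffAt (hU.mem_nhds hz.1))).contDiffWithinAt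
  · refine Subtype.ext ?_
    rw [hpv]
    have h1 := hBker (hker hz (hK x))
    rw [hb' hz] at h1
    exact h1.symm
  · change Ring.inverse (B z) (p v) = v
    rw [hpv, ← hBker hv, hb hz]

/-- **Frobenius theorem**, for the kernel of a field of projections `Q` on an open subset of a
finite-dimensional space: if the antisymmetrised differential of `Q` vanishes on `ker Q`, then
through each point passes a leaf `c`. The linear map `p` straightens the leaf. -/
theorem exists_leaf_of_fderiv_symm [FiniteDimensional ℝ E] {Q : E → E →L[ℝ] E} {U : Set E}
    (hU : IsOpen U) (hQ : ContDiffOn ℝ ∞ Q U) (hQQ : ∀ z ∈ U, Q z * Q z = Q z)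
    (hsymm : ∀ z ∈ U, ∀ v w, Q z v = 0 → Q z w = 0 → fderiv ℝ Q z v w = fderiv ℝ Q z w v)
    {z₀ : E} (hz₀ : z₀ ∈ U) :
    ∃ (k : ℕ) (r : ℝ) (c : EuclideanSpace ℝ (Fin k) → E) (p : E →L[ℝ] EuclideanSpace ℝ (Fin k)),
      0 < r ∧ c 0 = z₀ ∧ ContDiffOn ℝ ∞ c (ball 0 r) ∧ ∀ x ∈ ball 0 r, c x ∈ U ∧
        p (c x) = p z₀ + x ∧ ∀ v, Q (c x) v = 0 ↔ ∃ a, fderiv ℝ c x a = v := by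
  have : CompleteSpace E := FiniteDimensional.complete ℝ E
  obtain ⟨U', hU'U, hU', hz₀', F, p, hF, hQF, hpF, hFp⟩ := exists_frame_ker hU hQ hQQ hz₀
  let e : EuclideanSpace ℝ (Fin (Module.finrank ℝ (LinearMap.ker (Q z₀).toLinearMap))) ≃L[ℝ]
      LinearMap.ker (Q z₀).toLinearMap :=
    ContinuousLinearEquiv.ofFinrankEq (by simp)
  have hFd {z : E} (hz : z ∈ U') : DifferentiableAt ℝ F z :=
    (hF.contDiffAt (hU'.mem_nhds hz)).differentiableAt (by simp)
  have hQd {z : E} (hz : z ∈ U') : DifferentiableAt ℝ Q z :=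
    (hQ.contDiffAt (hU.mem_nhds (hU'U hz))).differentiableAt (by simp)
  -- The fields `z ↦ F z x` commute: their brackets lie in `ker Q` and are annihilated by `p`.
  have hFsymm : ∀ z ∈ U', ∀ h x, fderiv ℝ F z (F z h) x = fderiv ℝ F z (F z x) h := by
    intro z hz h x
    -- Differentiate `Q w (F w y) = 0`.
    have h1 (u : E) (y : LinearMap.ker (Q z₀).toLinearMap) :
        fderiv ℝ Q z u (F z y) = -Q z (fderiv ℝ F z u y) := by
      have h2 := (hQd hz).hasFDerivAt.clm_apply
        ((hFd hz).hasFDerivAt.clm_apply (hasFDerivAt_const y z))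
      have h3 : (fun w ↦ Q w (F w y)) =ᶠ[𝓝 z] fun _ ↦ 0 := by
        filter_upwards [hU'.mem_nhds hz] with w hw using hQF w hw y
      have h4 := congr($((h2.congr_of_eventuallyEq h3.symm).unique (hasFDerivAt_const 0 z)) u)
      simp only [ContinuousLinearMap.comp_zero, zero_add, add_apply,
        ContinuousLinearMap.comp_apply, ContinuousLinearMap.flip_apply, zero_apply] at h4
      rw [eq_neg_iff_add_eq_zero, add_comm]
      exact h4
    -- Differentiate `p (F w y) = y`.
    have h5 (u : E) (y : LinearMap.ker (Q z₀).toLinearMap) : p (fderiv ℝ F z u y) = 0 := by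
      have h2 := p.hasFDerivAt.comp z ((hFd hz).hasFDerivAt.clm_apply (hasFDerivAt_const y z))
      have h3 : (p ∘ fun w ↦ F w y) =ᶠ[𝓝 z] fun _ ↦ y := by
        filter_upwards [hU'.mem_nhds hz] with w hw using hpF w hw y
      have h4 := congr($((h2.congr_of_eventuallyEq h3.symm).unique (hasFDerivAt_const y z)) u)
      simpa using h4
    rw [← sub_eq_zero, ← hFp z hz (fderiv ℝ F z (F z h) x - fderiv ℝ F z (F z x) h)]
    · rw [map_sub, h5, h5, sub_zero, map_zero]
    · have := hsymm z (hU'U hz) (F z h) (F z x) (hQF z hz h) (hQF z hz x)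
      rw [h1, h1, neg_inj] at this
      rw [map_sub, this, sub_self]
  have hG : ContDiffOn ℝ ∞ (fun z ↦ F z ∘L e.toContinuousLinearMap) U' :=
    hF.clm_comp contDiffOn_const
  have hGd {z : E} (hz : z ∈ U') (u : E) (x) :
      fderiv ℝ (fun z ↦ F z ∘L e.toContinuousLinearMap) z u x = fderiv ℝ F z u (e x) := by
    have := (hFd hz).hasFDerivAt.clm_comp (hasFDerivAt_const e.toContinuousLinearMap z)
    rw [this.fderiv]
    simp
  obtain ⟨r, hr, c, hc0, hc⟩ := exists_hasFDerivAt_of_symm hU' (hG.of_le ENat.LEInfty.out)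
    (fun z hz h x ↦ by rw [hGd hz, hGd hz]; exact hFsymm z hz (e h) (e x)) hz₀'
  refine ⟨_, r, c, e.symm.toContinuousLinearMap ∘L p, hr, hc0,
    contDiffOn_of_hasFDerivAt_comp isOpen_ball hG hc, fun x hx ↦ ⟨hU'U (hc x hx).1, ?_, ?_⟩⟩
  · -- The derivative of `y ↦ e.symm (p (c y))` is the identity.
    have h1 : ∀ y ∈ ball 0 r,
        HasFDerivAt (𝕜 := ℝ) (fun y ↦ e.symm (p (c y)) - y) 0 y := by
      intro y hy
      have h2 := ((e.symm.toContinuousLinearMap ∘L p).hasFDerivAt.comp y (hc y hy).2).sub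
        (hasFDerivAt_id y)
      refine h2.congr_fderiv ?_
      ext v : 1
      simp [hpF _ (hc y hy).1]
    have h3 := isOpen_ball.is_const_of_fderiv_eq_zero (convex_ball _ _).isPreconnected
      (fun y hy ↦ (h1 y hy).differentiableAt.differentiableWithinAt)
      (fun y hy ↦ (h1 y hy).fderiv) hx (mem_ball_self hr)
    simp only [hc0, sub_zero] at h3
    exact sub_eq_iff_eq_add.1 h3
  · intro v
    rw [(hc x hx).2.fderiv]
    refine ⟨fun hv ↦ ⟨e.symm (p v), ?_⟩, ?_⟩
    · simpa using hFp _ (hc x hx).1 v hv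
    · rintro ⟨a, rfl⟩
      exact hQF _ (hc x hx).1 _

end Leaf

/-! ### Complementary projections and involutivity in a chart -/

section Complementary

open Set Filter Topology

variable {E : Type*} [NormedAddCommGroup E] [NormedSpace ℝ E]
  {H : Type*} [TopologicalSpace H] {I : ModelWithCorners ℝ E H}
  {M : Type*} [TopologicalSpace M] [ChartedSpace H M] [IsManifold I ∞ M]

/-- Every tangent vector is the value of a globally defined smooth vector field. -/
lemma exists_isSmoothField_eq [FiniteDimensional ℝ E] [T2Space M] {x : M} (v : TangentSpace I x) :
    ∃ X : Π x : M, TangentSpace I x, IsSmoothField I X ∧ X x = v := by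
  obtain ⟨s, hs, hsv⟩ := FiberBundle.exists_contMDiffOn_extend (k := ∞) I E v
  obtain ⟨u, hus, hu, hxu⟩ := mem_nhds_iff.1 hs
  obtain ⟨f, -, hf⟩ := (SmoothBumpFunction.nhds_basis_tsupport (I := I) x).mem_iff.1
    (hu.mem_nhds hxu)
  refine ⟨(f : M → ℝ) • FiberBundle.extend E v, ?_, ?_⟩
  · exact (f.contMDiff.contMDiffOn (s := u)).smul_section_of_tsupport hu hf (hsv.mono hus)
  · simp

namespace EndomorphismField

/-- Two smooth fields of endomorphisms are complementary projections. -/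
structure IsComplementary (P Q : EndomorphismField I M) : Prop where
  add_apply (x : M) (v : TangentSpace I x) : P.toFun x v + Q.toFun x v = v
  left_apply_right (x : M) (v : TangentSpace I x) : P.toFun x (Q.toFun x v) = 0
  right_apply_left (x : M) (v : TangentSpace I x) : Q.toFun x (P.toFun x v) = 0

namespace IsComplementary

variable {P Q : EndomorphismField I M}

lemma symm (h : P.IsComplementary Q) : Q.IsComplementary P where
  add_apply x v := by rw [add_comm, h.add_apply]
  left_apply_right := h.right_apply_left
  right_apply_left := h.left_apply_right

lemma right_apply_right (h : P.IsComplementary Q) (x : M) (v : TangentSpace I x) :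
    Q.toFun x (Q.toFun x v) = Q.toFun x v := by
  have := congr(Q.toFun x $(h.add_apply x v))
  rwa [map_add, h.right_apply_left, zero_add] at this

lemma left_apply_of_right_eq_zero (h : P.IsComplementary Q) {x : M} {v : TangentSpace I x}
    (hv : Q.toFun x v = 0) : P.toFun x v = v := by
  have := h.add_apply x v
  rwa [hv, add_zero] at this

variable [I.Boundaryless] [FiniteDimensional ℝ E] [CompleteSpace E]

omit [FiniteDimensional ℝ E] in
/-- On the image of `P`, the obstruction to involutivity is the antisymmetrised differential of the
complementary projection `Q`, read in a chart. -/
lemma fieldInChart_mlieBracket (h : P.IsComplementary Q) {X Y : Π x : M, TangentSpace I x}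
    (hX : IsSmoothField I X) (hY : IsSmoothField I Y) {x₀ : M} {z : E}
    (hz : z ∈ (extChartAt I x₀).target) :
    fieldInChart x₀ (applyField Q.toFun
        (mlieBracket I (applyField P.toFun X) (applyField P.toFun Y))) z =
      fderiv ℝ (endoInChart x₀ Q.toFun) z (fieldInChart x₀ (applyField P.toFun Y) z)
          (fieldInChart x₀ (applyField P.toFun X) z)
        - fderiv ℝ (endoInChart x₀ Q.toFun) z (fieldInChart x₀ (applyField P.toFun X) z)
          (fieldInChart x₀ (applyField P.toFun Y) z) :=
  fieldInChart_applyField_mlieBracket (hX.applyField P) (hY.applyField P)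
    (funext fun x ↦ h.right_apply_left x _) (funext fun x ↦ h.right_apply_left x _) hz
    (((contDiffOn_endoInChart Q).contDiffAt
      ((isOpen_extChartAt_target x₀).mem_nhds hz)).differentiableAt (by simp))

lemma fderiv_symm_of_isInvolutive [T2Space M] (h : P.IsComplementary Q)
    (hPQ : IsInvolutive I P.toFun Q.toFun) {x₀ : M} {z : E} (hz : z ∈ (extChartAt I x₀).target)
    {v w : E} (hv : endoInChart x₀ Q.toFun z v = 0) (hw : endoInChart x₀ Q.toFun z w = 0) :
    fderiv ℝ (endoInChart x₀ Q.toFun) z v w = fderiv ℝ (endoInChart x₀ Q.toFun) z w v := by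
  have key {v : E} (hv : endoInChart x₀ Q.toFun z v = 0) :
      ∃ X : Π x : M, TangentSpace I x, IsSmoothField I X ∧
        fieldInChart x₀ (applyField P.toFun X) z = v := by
    obtain ⟨X, hX, hXv⟩ := exists_isSmoothField_eq (chartSymmDeriv I x₀ z v)
    refine ⟨X, hX, ?_⟩
    rw [endoInChart_eq_zero_iff _ hz] at hv
    rw [fieldInChart, applyField, hXv, h.left_apply_of_right_eq_zero hv,
      chartDeriv_chartSymmDeriv hz]
  obtain ⟨X, hX, rfl⟩ := key hv
  obtain ⟨Y, hY, rfl⟩ := key hw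
  have := h.fieldInChart_mlieBracket hX hY hz
  rw [show applyField Q.toFun (mlieBracket I (applyField P.toFun X) (applyField P.toFun Y)) = 0
    from hPQ X Y hX hY] at this
  exact (sub_eq_zero.1 (this.symm.trans (map_zero _))).symm

omit [FiniteDimensional ℝ E] in
lemma isInvolutive_of_fderiv_symm (h : P.IsComplementary Q)
    (hPQ : ∀ (x₀ : M) (v w : E), endoInChart x₀ Q.toFun (extChartAt I x₀ x₀) v = 0 →
      endoInChart x₀ Q.toFun (extChartAt I x₀ x₀) w = 0 →
      fderiv ℝ (endoInChart x₀ Q.toFun) (extChartAt I x₀ x₀) v w =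
        fderiv ℝ (endoInChart x₀ Q.toFun) (extChartAt I x₀ x₀) w v) :
    IsInvolutive I P.toFun Q.toFun := by
  intro X Y hX hY
  have key (W : Π x : M, TangentSpace I x) (x₀ : M) : endoInChart x₀ Q.toFun
      (extChartAt I x₀ x₀) (fieldInChart x₀ (applyField P.toFun W) (extChartAt I x₀ x₀)) = 0 := by
    rw [endoInChart_fieldInChart _ _ (mem_extChartAt_target x₀), fieldInChart, applyField,
      applyField, h.right_apply_left, map_zero]
  have h0 (x₀ : M) : fieldInChart x₀ (applyField Q.toFun
      (mlieBracket I (applyField P.toFun X) (applyField P.toFun Y))) (extChartAt I x₀ x₀) = 0 := by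
    rw [h.fieldInChart_mlieBracket hX hY (mem_extChartAt_target x₀), sub_eq_zero]
    exact hPQ x₀ _ _ (key Y x₀) (key X x₀)
  ext x
  have h1 := congr(chartSymmDeriv I x (extChartAt I x x) $(h0 x))
  rw [fieldInChart, chartSymmDeriv_chartDeriv (mem_extChartAt_target x), map_zero] at h1
  rw [extChartAt_to_inv x] at h1
  exact h1

end IsComplementary
end EndomorphismField
end Complementary

/-! ### Integrable distributions are involutive -/

section Integrable

open Set Filter Topology

variable {E : Type*} [NormedAddCommGroup E] [NormedSpace ℝ E]
  {H : Type*} [TopologicalSpace H] {I : ModelWithCorners ℝ E H}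
  {M : Type*} [TopologicalSpace M] [ChartedSpace H M] [IsManifold I ∞ M] [I.Boundaryless]

lemma endoInChart_chartDeriv (A : Π x : M, TangentSpace I x →L[ℝ] TangentSpace I x) {x₀ x : M}
    (hx : x ∈ (extChartAt I x₀).source) (v : TangentSpace I x) :
    endoInChart x₀ A (extChartAt I x₀ x) (chartDeriv I x₀ x v) = chartDeriv I x₀ x (A x v) := by
  obtain ⟨z, hz, rfl⟩ : ∃ z ∈ (extChartAt I x₀).target, (extChartAt I x₀).symm z = x :=
    ⟨_, (extChartAt I x₀).map_source hx, (extChartAt I x₀).left_inv hx⟩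
  rw [(extChartAt I x₀).right_inv hz, endoInChart_apply, chartSymmDeriv_chartDeriv hz]

lemma exists_chartDeriv_eq {x₀ x : M} (hx : x ∈ (extChartAt I x₀).source) (v : E) :
    ∃ w : TangentSpace I x, chartDeriv I x₀ x w = v := by
  obtain ⟨z, hz, rfl⟩ : ∃ z ∈ (extChartAt I x₀).target, (extChartAt I x₀).symm z = x :=
    ⟨_, (extChartAt I x₀).map_source hx, (extChartAt I x₀).left_inv hx⟩
  exact ⟨_, chartDeriv_chartSymmDeriv hz v⟩

lemma chartDeriv_injective {x₀ x : M} (hx : x ∈ (extChartAt I x₀).source) :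
    Function.Injective (chartDeriv I x₀ x) := by
  obtain ⟨z, hz, rfl⟩ : ∃ z ∈ (extChartAt I x₀).target, (extChartAt I x₀).symm z = x :=
    ⟨_, (extChartAt I x₀).map_source hx, (extChartAt I x₀).left_inv hx⟩
  exact Function.LeftInverse.injective (chartSymmDeriv_chartDeriv hz)

section
variable {V : Type*} [NormedAddCommGroup V] [NormedSpace ℝ V]
  {N : Type*} [TopologicalSpace N] [ChartedSpace V N] [IsManifold 𝓘(ℝ, V) ∞ N]

omit [I.Boundaryless] in
lemma hasFDerivAt_extChartAt_comp {ι : N → M} (hι : ContMDiff 𝓘(ℝ, V) I ∞ ι) {x₀ : M} {y₀ : N}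
    {u : V} (hu : u ∈ (extChartAt 𝓘(ℝ, V) y₀).target)
    (hx : ι ((extChartAt 𝓘(ℝ, V) y₀).symm u) ∈ (extChartAt I x₀).source) :
    HasFDerivAt (extChartAt I x₀ ∘ ι ∘ (extChartAt 𝓘(ℝ, V) y₀).symm)
      (chartDeriv I x₀ _ ∘L mfderiv 𝓘(ℝ, V) I ι _ ∘L chartSymmDeriv 𝓘(ℝ, V) y₀ u) u := by
  have h1 : HasMFDerivAt 𝓘(ℝ, V) 𝓘(ℝ, V) (extChartAt 𝓘(ℝ, V) y₀).symm u
      (chartSymmDeriv 𝓘(ℝ, V) y₀ u) :=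
    (((contMDiffOn_extChartAt_symm (n := ∞) y₀).contMDiffAt
      ((isOpen_extChartAt_target y₀).mem_nhds hu)).mdifferentiableAt (by simp)).hasMFDerivAt
  have h2 := ((hι ((extChartAt 𝓘(ℝ, V) y₀).symm u)).mdifferentiableAt (by simp)).hasMFDerivAt
  have h3 : HasMFDerivAt I 𝓘(ℝ, E) (extChartAt I x₀) (ι ((extChartAt 𝓘(ℝ, V) y₀).symm u))
      (chartDeriv I x₀ _) :=
    ((contMDiffAt_extChartAt' (n := ∞) (by simpa using hx)).mdifferentiableAt
      (by simp)).hasMFDerivAt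
  exact (h3.comp u (h2.comp u h1)).hasFDerivAt

omit [I.Boundaryless] in
lemma contDiffAt_extChartAt_comp {ι : N → M} (hι : ContMDiff 𝓘(ℝ, V) I ∞ ι) {x₀ : M} {y₀ : N}
    {u : V} (hu : u ∈ (extChartAt 𝓘(ℝ, V) y₀).target)
    (hx : ι ((extChartAt 𝓘(ℝ, V) y₀).symm u) ∈ (extChartAt I x₀).source) :
    ContDiffAt ℝ ∞ (extChartAt I x₀ ∘ ι ∘ (extChartAt 𝓘(ℝ, V) y₀).symm) u := by
  rw [← contMDiffAt_iff_contDiffAt]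
  exact (contMDiffAt_extChartAt' (n := ∞) (by simpa using hx)).comp u
    ((hι _).comp u ((contMDiffOn_extChartAt_symm (n := ∞) y₀).contMDiffAt
      ((isOpen_extChartAt_target y₀).mem_nhds hu)))

end

namespace EndomorphismField.IsComplementary

variable [CompleteSpace E] {P Q : EndomorphismField I M}

/-- An integrable distribution is involutive: its leaves are tangent to it, and second differentials
of the leaves are symmetric. -/
lemma isInvolutive_of_isIntegrable (h : P.IsComplementary Q)
    (hD : IsIntegrable fun x ↦ LinearMap.ker (Q.toFun x).toLinearMap) :
    IsInvolutive I P.toFun Q.toFun := by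
  refine h.isInvolutive_of_fderiv_symm fun x v w hv hw ↦ ?_
  obtain ⟨k, N, _, _, _, _, _, ι, hι, -, ⟨y₀, rfl⟩, hr⟩ := hD x
  set ψ := extChartAt (𝓡 k) y₀ with hψ
  have hιs : ContMDiff (𝓡 k) I ∞ ι := hι.contMDiff
  have hy₀ : ψ.symm (ψ y₀) = y₀ := extChartAt_to_inv y₀
  have hnear : ∀ᶠ u in 𝓝 (ψ y₀), u ∈ ψ.target ∧ ι (ψ.symm u) ∈ (extChartAt I (ι y₀)).source := by
    refine Eventually.and (extChartAt_target_mem_nhds (I := 𝓡 k) y₀) ?_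
    have : ContinuousAt (ι ∘ ψ.symm) (ψ y₀) :=
      hιs.continuous.continuousAt.comp (continuousAt_extChartAt_symm y₀)
    refine this.eventually_mem ?_
    simp only [Function.comp, hy₀]
    exact extChartAt_source_mem_nhds _
  obtain ⟨hu₀, hx₀⟩ := hnear.self_of_nhds
  set c := extChartAt I (ι y₀) ∘ ι ∘ ψ.symm with hc
  have hc₀ : c (ψ y₀) = extChartAt I (ι y₀) (ι y₀) := by simp only [hc, Function.comp, hy₀]
  have hcd {u} (hu : u ∈ ψ.target ∧ ι (ψ.symm u) ∈ (extChartAt I (ι y₀)).source) :=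
    (hasFDerivAt_extChartAt_comp hιs hu.1 hu.2).fderiv
  -- Every tangent vector of the distribution at `ι y₀` is a derivative of the leaf.
  have key {v : E} (hv : endoInChart (ι y₀) Q.toFun (extChartAt I (ι y₀) (ι y₀)) v = 0) :
      ∃ a, fderiv ℝ c (ψ y₀) a = v := by
    obtain ⟨w, rfl⟩ := exists_chartDeriv_eq hx₀ v
    rw [← hc₀] at hv
    have hw : Q.toFun _ w = 0 := by
      refine chartDeriv_injective hx₀ ?_
      rw [← endoInChart_chartDeriv _ hx₀, map_zero]
      exact hv
    have hw' : w ∈ LinearMap.range (mfderiv (𝓡 k) I ι (ψ.symm (ψ y₀))).toLinearMap := by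
      rw [hr]
      exact hw
    obtain ⟨b, rfl⟩ := hw'
    refine ⟨chartDeriv (𝓡 k) y₀ _ b, ?_⟩
    rw [hcd ⟨hu₀, hx₀⟩]
    exact congrArg (fun b ↦ chartDeriv I (ι y₀) _ (mfderiv (𝓡 k) I ι _ b))
      (chartSymmDeriv_chartDeriv hu₀ b)
  obtain ⟨a, rfl⟩ := key hv
  obtain ⟨b, rfl⟩ := key hw
  rw [← hc₀]
  refine fderiv_symm_of_comp_fderiv_eq_zero ?_
    ((contDiffAt_extChartAt_comp hιs hu₀ hx₀).of_le ENat.LEInfty.out)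
    (hnear.mono fun u hu a ↦ ?_) a b
  · change DifferentiableAt ℝ _ (c (ψ y₀))
    rw [hc₀]
    exact ((contDiffOn_endoInChart Q).contDiffAt
      (extChartAt_target_mem_nhds (ι y₀))).differentiableAt (by simp)
  · rw [hcd hu]
    refine (endoInChart_chartDeriv Q.toFun hu.2 _).trans ?_
    have : mfderiv (𝓡 k) I ι (ψ.symm u) (chartSymmDeriv (𝓡 k) y₀ u a) ∈
        LinearMap.ker (Q.toFun (ι (ψ.symm u))).toLinearMap := by
      exact (hr _).le ⟨_, rfl⟩
    exact (congrArg (chartDeriv I (ι y₀) _) this).trans (map_zero _)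

end EndomorphismField.IsComplementary
end Integrable

/-! ### Involutive distributions are integrable -/

section Involutive

open Metric Set Filter Topology

universe u

variable {E : Type*} [NormedAddCommGroup E] [NormedSpace ℝ E]
  {V : Type*} [NormedAddCommGroup V] [NormedSpace ℝ V]

/-- The shear `z ↦ z - c (s z) + i (s z)`, `s z = p z - p z₀`, which straightens a parametrised
submanifold `c` with `p (c x) = p z₀ + x` to the image of a section `i` of `p`. -/
def shear {c : V → E} {p : E →L[ℝ] V} {z₀ : E} {r : ℝ} {i : V →L[ℝ] E}
    (hc : ContinuousOn c (ball 0 r)) (hpc : ∀ x ∈ ball (0 : V) r, p (c x) = p z₀ + x)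
    (hpi : ∀ x, p (i x) = x) : OpenPartialHomeomorph E E where
  toFun z := z - c (p z - p z₀) + i (p z - p z₀)
  invFun w := w - i (p w) + c (p w)
  source := {z | p z - p z₀ ∈ ball (0 : V) r}
  target := {w | p w ∈ ball (0 : V) r}
  map_source' z (hz : _ ∈ _) := by
    change p (z - c (p z - p z₀) + i (p z - p z₀)) ∈ ball (0 : V) r
    rw [map_add, map_sub, hpc _ hz, hpi]
    simpa using hz
  map_target' w (hw : _ ∈ _) := by
    change p (w - i (p w) + c (p w)) - p z₀ ∈ ball (0 : V) r
    rw [map_add, map_sub, hpc _ hw, hpi]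
    simpa using hw
  left_inv' z (hz : _ ∈ _) := by
    have h : p (z - c (p z - p z₀) + i (p z - p z₀)) = p z - p z₀ := by
      rw [map_add, map_sub, hpc _ hz, hpi]
      abel
    simp only [h]
    abel
  right_inv' w (hw : _ ∈ _) := by
    have h : p (w - i (p w) + c (p w)) - p z₀ = p w := by
      rw [map_add, map_sub, hpc _ hw, hpi]
      abel
    simp only [h]
    abel
  open_source := isOpen_ball.preimage (f := fun z ↦ p z - p z₀) (by fun_prop)
  open_target := isOpen_ball.preimage p.continuous
  continuousOn_toFun := by
    refine (continuousOn_id.sub (hc.comp ?_ fun z hz ↦ hz)).add ?_ <;> fun_prop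
  continuousOn_invFun := by
    refine ContinuousOn.add ?_ (hc.comp ?_ fun z hz ↦ hz) <;> fun_prop

lemma contDiffOn_shear {c : V → E} {p : E →L[ℝ] V} {z₀ : E} {r : ℝ} {i : V →L[ℝ] E}
    (hc : ContDiffOn ℝ ∞ c (ball 0 r)) (hpc : ∀ x ∈ ball (0 : V) r, p (c x) = p z₀ + x)
    (hpi : ∀ x, p (i x) = x) :
    ContDiffOn ℝ ∞ (shear hc.continuousOn hpc hpi) {z | p z - p z₀ ∈ ball (0 : V) r} := by
  refine (contDiffOn_id.sub (hc.comp (g := c) ?_ fun z hz ↦ hz)).add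
    (ContDiff.contDiffOn ?_) <;> fun_prop

lemma contDiffOn_shear_symm {c : V → E} {p : E →L[ℝ] V} {z₀ : E} {r : ℝ} {i : V →L[ℝ] E}
    (hc : ContDiffOn ℝ ∞ c (ball 0 r)) (hpc : ∀ x ∈ ball (0 : V) r, p (c x) = p z₀ + x)
    (hpi : ∀ x, p (i x) = x) :
    ContDiffOn ℝ ∞ (shear hc.continuousOn hpc hpi).symm {w | p w ∈ ball (0 : V) r} := by
  refine ContDiffOn.add (ContDiff.contDiffOn ?_) (hc.comp (g := c) ?_ fun z hz ↦ hz) <;> fun_prop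

section Chart

variable {M : Type*} [TopologicalSpace M] [ChartedSpace E M] [IsManifold 𝓘(ℝ, E) ∞ M]
  {N : Type*} [TopologicalSpace N] [ChartedSpace V N] [IsManifold 𝓘(ℝ, V) ∞ N]
  {c : V → E} {p : E →L[ℝ] V} {r : ℝ} {x₀ : M} {e : OpenPartialHomeomorph N V}

/-- A parametrised submanifold of a chart domain, which is straightened by a linear map `p`, is an
immersion. -/
lemma isImmersion_symm_comp (he : ∀ n, chartAt V n = e) (hes : e.source = univ)
    (het : e.target = ball 0 r) (hr : 0 < r) {z₀ : E} (hc : ContDiffOn ℝ ∞ c (ball 0 r))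
    (hct : ∀ x ∈ ball 0 r, c x ∈ (extChartAt 𝓘(ℝ, E) x₀).target)
    (hpc : ∀ x ∈ ball 0 r, p (c x) = p z₀ + x) :
    Manifold.IsImmersion 𝓘(ℝ, V) 𝓘(ℝ, E) ∞ fun n : N ↦ (extChartAt 𝓘(ℝ, E) x₀).symm (c (e n)) := by
  have hb (n : N) : e n ∈ ball (0 : V) r := het ▸ e.map_source (hes ▸ mem_univ n)
  set i := fderiv ℝ c 0 with hi
  -- Differentiating `p (c x) = p z₀ + x` shows that `i` is a section of `p`.
  have hpi (x : V) : p (i x) = x := by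
    have h0 : ball (0 : V) r ∈ 𝓝 0 := ball_mem_nhds 0 hr
    have h1 : HasFDerivAt c i 0 := ((hc.contDiffAt h0).differentiableAt (by simp)).hasFDerivAt
    have h2 : HasFDerivAt (fun x ↦ p (c x)) (.id ℝ V) 0 :=
      ((hasFDerivAt_id _).const_add (p z₀)).congr_of_eventuallyEq <| by
        filter_upwards [h0] with x hx using hpc x hx
    exact congr($((p.hasFDerivAt.comp _ h1).unique h2) x)
  let S := shear hc.continuousOn hpc hpi
  let ψ : OpenPartialHomeomorph M E := (chartAt E x₀).trans S
  have hct' {x : V} (hx : x ∈ ball 0 r) : c x ∈ (chartAt E x₀).target := by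
    simpa using hct x hx
  have hψ : ψ ∈ IsManifold.maximalAtlas 𝓘(ℝ, E) ∞ M := by
    refine ψ.mem_maximalAtlas_of_contMDiffOn ?_ ?_
    · exact (contDiffOn_shear hc hpc hpi).contMDiffOn.comp
        ((contMDiffOn_chart (x := x₀)).mono fun y hy ↦ hy.1) fun y hy ↦ hy.2
    · exact (contMDiffOn_chart_symm (x := x₀)).comp
        ((contDiffOn_shear_symm hc hpc hpi).contMDiffOn.mono fun y hy ↦ hy.1) fun y hy ↦ hy.2
  have hS {x : V} (hx : x ∈ ball 0 r) : S (c x) = i x := by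
    change c x - c (p (c x) - p z₀) + i (p (c x) - p z₀) = i x
    simp [hpc x hx]
  have hSs {x : V} (hx : x ∈ ball 0 r) : c x ∈ S.source := by
    change p (c x) - p z₀ ∈ ball (0 : V) r
    simpa [hpc x hx] using hx
  let K := LinearMap.ker p.toLinearMap
  let equiv : (V × K) ≃L[ℝ] E := ContinuousLinearEquiv.equivOfInverse
    (i.coprod K.subtypeL)
    (p.prod ((ContinuousLinearMap.id ℝ E - i ∘L p).codRestrict K fun z ↦ by
      simp [K, hpi]))
    (by
      rintro ⟨v, w, hw⟩
      have hw' : p w = 0 := hw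
      ext <;> simp [hpi, hw'])
    (by intro z; simp)
  have hψs (n : N) : (extChartAt 𝓘(ℝ, E) x₀).symm (c (e n)) ∈ ψ.source := by
    have h := hct' (hb n)
    refine ⟨by simpa using (chartAt E x₀).map_target h, ?_⟩
    simpa [(chartAt E x₀).right_inv h] using hSs (hb n)
  refine Manifold.IsImmersionOfComplement.isImmersion (F := K) fun n ↦ ?_
  refine .mk_of_charts equiv e ψ (hes ▸ mem_univ n) (hψs n)
    (he n ▸ IsManifold.chart_mem_maximalAtlas n) hψ (fun n _ ↦ hψs n) fun x hx ↦ ?_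
  have hx' : x ∈ ball 0 r := by simpa [het] using hx
  have hex : e (e.symm x) = x := e.right_inv (het ▸ hx')
  have : ψ ((chartAt E x₀).symm (c x)) = i x := by
    rw [← hS hx']
    exact congrArg S ((chartAt E x₀).right_inv (hct' hx'))
  simpa [hex, equiv] using this

/-- The tangent space of a parametrised submanifold of a chart domain is the distribution to which
the submanifold is tangent in the chart. -/
lemma range_mfderiv_symm_comp (he : ∀ n, chartAt V n = e) (hes : e.source = univ)
    (het : e.target = ball 0 r) (hc : ContDiffOn ℝ ∞ c (ball 0 r))
    (hct : ∀ x ∈ ball 0 r, c x ∈ (extChartAt 𝓘(ℝ, E) x₀).target)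
    (A : Π x : M, TangentSpace 𝓘(ℝ, E) x →L[ℝ] TangentSpace 𝓘(ℝ, E) x)
    (hA : ∀ x ∈ ball 0 r, ∀ v, endoInChart x₀ A (c x) v = 0 ↔ ∃ a, fderiv ℝ c x a = v) (n : N) :
    LinearMap.range (mfderiv 𝓘(ℝ, V) 𝓘(ℝ, E)
        (fun n : N ↦ (extChartAt 𝓘(ℝ, E) x₀).symm (c (e n))) n).toLinearMap =
      LinearMap.ker (A ((extChartAt 𝓘(ℝ, E) x₀).symm (c (e n)))).toLinearMap := by
  have hn : e n ∈ ball (0 : V) r := het ▸ e.map_source (hes ▸ mem_univ n)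
  have hext : (extChartAt 𝓘(ℝ, V) n : N → V) = e := by simp [← he n]
  have h1 : HasMFDerivAt 𝓘(ℝ, V) 𝓘(ℝ, V) e n (chartDeriv 𝓘(ℝ, V) n n) := by
    rw [← hext]
    exact ((contMDiffAt_extChartAt (n := ∞)).mdifferentiableAt (by simp)).hasMFDerivAt
  have h2 : HasMFDerivAt 𝓘(ℝ, V) 𝓘(ℝ, E) c (e n) (fderiv ℝ c (e n)) :=
    ((hc.contDiffAt (isOpen_ball.mem_nhds hn)).differentiableAt (by simp)).hasFDerivAt.hasMFDerivAt
  have h3 : HasMFDerivAt 𝓘(ℝ, E) 𝓘(ℝ, E) (extChartAt 𝓘(ℝ, E) x₀).symm (c (e n))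
      (chartSymmDeriv 𝓘(ℝ, E) x₀ (c (e n))) :=
    (((contMDiffOn_extChartAt_symm (n := ∞) x₀).contMDiffAt
      ((isOpen_extChartAt_target x₀).mem_nhds (hct _ hn))).mdifferentiableAt
        (by simp)).hasMFDerivAt
  have h4 := (h3.comp n (h2.comp n h1)).mfderiv
  have h5 (b) : mfderiv 𝓘(ℝ, V) 𝓘(ℝ, E) (fun n : N ↦ (extChartAt 𝓘(ℝ, E) x₀).symm (c (e n))) n b =
      chartSymmDeriv 𝓘(ℝ, E) x₀ (c (e n)) (fderiv ℝ c (e n) (chartDeriv 𝓘(ℝ, V) n n b)) :=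
    congr($h4 b)
  ext v
  constructor
  · rintro ⟨b, rfl⟩
    refine Eq.trans (congrArg _ (h5 b)) ?_
    exact (endoInChart_eq_zero_iff A (hct _ hn) _).1 ((hA _ hn _).2 ⟨_, rfl⟩)
  · intro hv
    have hv' := chartSymmDeriv_chartDeriv (hct _ hn) v
    obtain ⟨a, ha⟩ := (hA _ hn (chartDeriv 𝓘(ℝ, E) x₀ _ v)).1 <| by
      rw [endoInChart_eq_zero_iff A (hct _ hn), hv']
      exact hv
    obtain ⟨b, rfl⟩ := exists_chartDeriv_eq (mem_extChartAt_source (I := 𝓘(ℝ, V)) n) a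
    exact ⟨b, (h5 b).trans (by rw [ha, hv'])⟩

end Chart

variable {M : Type u} [TopologicalSpace M] [ChartedSpace E M] [IsManifold 𝓘(ℝ, E) ∞ M]

/-- **Frobenius theorem** on a manifold. The leaf through `x` is parametrised by a ball of a
Euclidean space; the ball is lifted to the universe of `M`, as required by `IsIntegrable`. -/
theorem EndomorphismField.IsComplementary.isIntegrable_of_isInvolutive [T2Space M]
    [FiniteDimensional ℝ E] {P Q : EndomorphismField 𝓘(ℝ, E) M} (h : P.IsComplementary Q)
    (hPQ : IsInvolutive 𝓘(ℝ, E) P.toFun Q.toFun) :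
    IsIntegrable fun x ↦ LinearMap.ker (Q.toFun x).toLinearMap := by
  intro x
  have : CompleteSpace E := FiniteDimensional.complete ℝ E
  obtain ⟨k, r, c, p, hr, hc0, hc, hcp⟩ := exists_leaf_of_fderiv_symm
    (isOpen_extChartAt_target (I := 𝓘(ℝ, E)) x) (contDiffOn_endoInChart Q)
    (fun z hz ↦ by
      ext v
      change endoInChart x Q.toFun z (endoInChart x Q.toFun z v) = endoInChart x Q.toFun z v
      rw [endoInChart_apply, endoInChart_apply, chartSymmDeriv_chartDeriv hz, h.right_apply_right])
    (fun z hz v w hv hw ↦ h.fderiv_symm_of_isInvolutive hPQ hz hv hw) (mem_extChartAt_target x)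
  let N : Type u := ULift.{u} (ball (0 : EuclideanSpace ℝ (Fin k)) r)
  let f : N → EuclideanSpace ℝ (Fin k) := fun n ↦ n.down.val
  have hf : IsOpenEmbedding f :=
    isOpen_ball.isOpenEmbedding_subtypeVal.comp Homeomorph.ulift.isOpenEmbedding
  have hfr : range f = ball 0 r := by
    ext y
    exact ⟨by rintro ⟨n, rfl⟩; exact n.down.2, fun hy ↦ ⟨⟨⟨y, hy⟩⟩, rfl⟩⟩
  have : Nonempty N := ⟨⟨⟨0, mem_ball_self hr⟩⟩⟩
  let e := hf.toOpenPartialHomeomorph f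
  have hes : e.source = univ := hf.toOpenPartialHomeomorph_source f
  have het : e.target = ball 0 r := (hf.toOpenPartialHomeomorph_target f).trans hfr
  let _ : ChartedSpace (EuclideanSpace ℝ (Fin k)) N := hf.singletonChartedSpace
  have hN : IsManifold (𝓡 k) ∞ N := hf.isManifold_singleton
  refine ⟨k, N, inferInstance, inferInstance, hf.isEmbedding.secondCountableTopology,
    inferInstance, hN, fun n ↦ (extChartAt 𝓘(ℝ, E) x).symm (c (e n)), ?_, ?_, ?_, ?_⟩
  · exact isImmersion_symm_comp (fun _ ↦ rfl) hes het hr hc (fun x hx ↦ (hcp x hx).1)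
      fun x hx ↦ (hcp x hx).2.1
  · intro n n' hnn
    have h1 := (extChartAt 𝓘(ℝ, E) x).symm.injOn (hcp _ n.down.2).1 (hcp _ n'.down.2).1 hnn
    have h2 := congrArg p h1
    rw [(hcp _ n.down.2).2.1, (hcp _ n'.down.2).2.1] at h2
    exact hf.injective (add_left_cancel h2)
  · refine ⟨⟨⟨0, mem_ball_self hr⟩⟩, ?_⟩
    change (extChartAt 𝓘(ℝ, E) x).symm (c 0) = x
    rw [hc0, extChartAt_to_inv]
  · exact range_mfderiv_symm_comp (fun _ ↦ rfl) hes het hc (fun x hx ↦ (hcp x hx).1) Q.toFun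
      fun x hx ↦ (hcp x hx).2.2

end Involutive

/-! ### Integrability of the metallic distributions -/

section Metallic

namespace EndomorphismField

variable {E : Type*} [NormedAddCommGroup E] [NormedSpace ℝ E]

theorem IsComplementary.isIntegrable_iff {M : Type*} [TopologicalSpace M] [T2Space M]
    [ChartedSpace E M] [IsManifold 𝓘(ℝ, E) ∞ M] [FiniteDimensional ℝ E]
    {P Q : EndomorphismField 𝓘(ℝ, E) M} (h : P.IsComplementary Q) :
    IsIntegrable (fun x ↦ LinearMap.ker (Q.toFun x).toLinearMap) ↔
      IsInvolutive 𝓘(ℝ, E) P.toFun Q.toFun :=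
  have : CompleteSpace E := FiniteDimensional.complete ℝ E
  ⟨h.isInvolutive_of_isIntegrable, h.isIntegrable_of_isInvolutive⟩

variable {H : Type*} [TopologicalSpace H] {I : ModelWithCorners ℝ E H}
  {M : Type*} [TopologicalSpace M] [ChartedSpace H M] [IsManifold I ∞ M]
  (J : EndomorphismField I M) {g : PseudoRiemannianMetric I M} {p q : ℝ}

lemma isComplementary_projField (hJ : J.IsMetallic g p q) (hpq : 0 < p ^ 2 + 4 * q) :
    (J.projField p q).IsComplementary (J.projField' p q) where
  add_apply x v := by rw [projField_toFun, projField'_toFun, proj_add_proj' hpq]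
  left_apply_right x v := by rw [projField_toFun, projField'_toFun, proj_proj' hJ hpq]
  right_apply_left x v := by rw [projField_toFun, projField'_toFun, proj'_proj hJ hpq]

end EndomorphismField
end Metallic

theorem mainTheorem1 {m : ℕ} {M : Type*} [TopologicalSpace M] [T2Space M]
    [SecondCountableTopology M] [ChartedSpace (EuclideanSpace ℝ (Fin m)) M] [IsManifold (𝓡 m) ∞ M]
    (g : PseudoRiemannianMetric (𝓡 m) M) (J : EndomorphismField (𝓡 m) M) (p q : ℝ)
    (hJ : J.IsMetallic g p q) (hpq : 0 < p ^ 2 + 4 * q) :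
    List.TFAE [
      IsIntegrable (J.distribution p q) ∧ IsIntegrable (J.distribution' p q),
      VanishesOnSmooth (𝓡 m) J.nijenhuis,
      VanishesOnSmooth (𝓡 m) (J.twisting g p q) ∧ VanishesOnSmooth (𝓡 m) (J.twisting' g p q),
      VanishesOnSmooth (𝓡 m) (torsionOf (J.vidal g p q))] := by
  have hc := J.isComplementary_projField hJ hpq
  have hD : IsIntegrable (J.distribution p q) ↔
      IsInvolutive (𝓡 m) (J.proj p q) (J.proj' p q) := by
    rw [← J.projField_toFun, ← J.projField'_toFun]
    refine Iff.trans ?_ hc.isIntegrable_iff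
    rw [J.projField'_toFun]
    rfl
  have hD' : IsIntegrable (J.distribution' p q) ↔
      IsInvolutive (𝓡 m) (J.proj' p q) (J.proj p q) := by
    rw [← J.projField_toFun, ← J.projField'_toFun]
    refine Iff.trans ?_ hc.symm.isIntegrable_iff
    rw [J.projField_toFun]
    rfl
  rw [hD, hD', EndomorphismField.vanishesOnSmooth_nijenhuis_iff hJ hpq,
    EndomorphismField.vanishesOnSmooth_twisting_iff,
    EndomorphismField.vanishesOnSmooth_twisting'_iff,
    EndomorphismField.vanishesOnSmooth_torsionOf_vidal_iff hJ hpq]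
  simp
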